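/- **Setting.** Let $n\ge 1$, let $\Omega\subset\mathbb R^n$ be a bounded open set with Lipschitz boundary, and let $K=\overline K\subset\Omega$ be a closed, countably rectifiable hypersurface with $\mathcal H^{n-1}(K)<+\infty$. Put $\mu=\mathcal L^n+\mathcal H^{n-1}|_K$ and $$W^{1,2}_\mu(\Omega,\mathbb R^n)=\Big\{u\in BV(\Omega,\mathbb R^n): |Du|\ll\mu,\ \int_\Omega\Big|\frac{Du}{\mu}\Big|^2d\mu<+\infty\Big\}.$$ For such $u$ let $\nabla u$ be the density of the absolutely continuous part of $Du$ with respect to $\mathcal L^n$. Let $u_0\in W^{1,2}_\mu(\Omega,\mathbb R^n)\cap L^\infty(\Omega,\mathbb R^n)$, and let $W^{1,2}_\mu(\Omega,\mathbb R^n,u_0)$ be the set of all $u\in W^{1,2}_\mu(\Omega,\mathbb R^n)$ with $u=u_0$ on $\partial\Omega$ in the sense of traces. Let $\mathbf C=(\mathbf C_{ijkl})$ be a constant fourth-order elasticity tensor with $\mathbf C_{ijkl}=\mathbf C_{jikl}=\mathbf C_{ijlk}=\mathbf C_{klij}$ and, for some $c>0$, $\frac12\mathbf C z:z\ge c\,|z^{sym}|^2$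 for all $z\in\mathbb R^{n\times n}$, where $z^{sym}$ is the symmetric part of $z$; for symmetric $s$ let $\mathbf C^{-1}s$ be the unique symmetric $e$ with $\mathbf C e=s$. Let $$F(u)=\frac12\int_\Omega\mathbf C\nabla u:\nabla u\,dx,\qquad u\in W^{1,2}_\mu(\Omega,\mathbb R^n,u_0).$$ The space of admissible stresses is $$Y_K(\Omega)=\{\sigma=\sigma^T\in L^2(\Omega,\mathbb R^{n\times n}):\ \operatorname{div}\sigma=0 \text{ in }\Omega,\ \ \sigma\mathbf n=0\text{ on }K\}.$$ Here $\operatorname{div}\sigma=0$ is understood in the sense of distributions, and $\sigma\mathbf n=0$ on $K$ in the weak sense (on both faces of $K$): $\int_{\Omega\setminus K}\sigma:\nabla\varphi\,dx=0$ for every $\varphi\in W^{1,2}(\Omega\setminus K,\mathbb R^n)$ that vanishes outside a compact subset of $\Omega$. For $\sigma\in Y_K(\Omega)$ the integral $\int_{\partial\Omega}(\sigma\mathbf n)\cdot u_0\,d\mathcal H^{n-1}$ is the duality pairing of the normal trace $\sigma\mathbf n$ with the trace of $u_0$ on $\partial\Omega$, that is, the number $\int_\Omega\sigma:\nabla w\,dx$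 for any $w\in W^{1,2}(\Omega,\mathbb R^n)$ with $w=u_0$ on $\partial\Omega$ in the sense of traces. **Proposition.** For every $\sigma\in Y_K(\Omega)$ and every minimizer $u$ of $F$ over $W^{1,2}_\mu(\Omega,\mathbb R^n,u_0)$, the pairing $\int_{\partial\Omega}(\sigma\mathbf n)\cdot u_0\,d\mathcal H^{n-1}$ is well defined (such a $w$ exists, and the value does not depend on its choice) and $$\int_{\partial\Omega}(\sigma\mathbf n)\cdot u_0\,d\mathcal H^{n-1}-\frac12\int_\Omega\mathbf C^{-1}\sigma:\sigma\,dx\ \le\ F(u).$$ -/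

import Mathlib

open MeasureTheory Set
open scoped ContDiff NNReal ENNReal

namespace CrackedBody

/-- The Euclidean space `ℝⁿ`. -/
abbrev Vec (n : ℕ) : Type := EuclideanSpace ℝ (Fin n)

/-- Real `n × n` matrices. -/
abbrev Mat (n : ℕ) : Type := Matrix (Fin n) (Fin n) ℝ

variable {n : ℕ}

/-! ### Matrices and elasticity tensors -/

/-- The scalar product `A : B = ∑ᵢⱼ Aᵢⱼ Bᵢⱼ` of matrices. -/
def ddot (A B : Mat n) : ℝ := ∑ i, ∑ j, A i j * B i j

/-- The symmetric part of a matrix. -/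
noncomputable def symPart (z : Mat n) : Mat n := (1 / 2 : ℝ) • (z + z.transpose)

/-- A tensor of order four acting on matrices, `(C z)ᵢⱼ = ∑ₖₗ Cᵢⱼₖₗ zₖₗ`. -/
def tensorApply (C : Fin n → Fin n → Fin n → Fin n → ℝ) (z : Mat n) : Mat n :=
  Matrix.of fun i j => ∑ k, ∑ l, C i j k l * z k l

/-- Symmetric positive definite elasticity tensors of order four:
`Cᵢⱼₖₗ = Cⱼᵢₖₗ = Cᵢⱼₗₖ = Cₖₗᵢⱼ` and `(1/2) C z : z ≥ c |z^sym|²` for some `c > 0`. -/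
structure IsElasticityTensor (C : Fin n → Fin n → Fin n → Fin n → ℝ) : Prop where
  symm_left : ∀ i j k l, C i j k l = C j i k l
  symm_right : ∀ i j k l, C i j k l = C i j l k
  symm_major : ∀ i j k l, C i j k l = C k l i j
  pos : ∃ c : ℝ, 0 < c ∧
    ∀ z : Mat n, c * ddot (symPart z) (symPart z) ≤ 1 / 2 * ddot (tensorApply C z) z

/-- `C⁻¹ s`: the symmetric matrix `e` with `C e = s`. For an elasticity tensor `C` and a symmetric
matrix `s` it exists and is unique, see `existsUnique_tensorApply_eq`. -/
noncomputable def tensorInv (C : Fin n → Fin n → Fin n → Fin n → ℝ) (s : Mat n) : Mat n :=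
  Function.invFunOn (tensorApply C) {e : Mat n | e.IsSymm} s

theorem existsUnique_tensorApply_eq {C : Fin n → Fin n → Fin n → Fin n → ℝ}
    (hC : IsElasticityTensor C) {s : Mat n} (hs : s.IsSymm) :
    ∃! e : Mat n, e.IsSymm ∧ tensorApply C e = s := by
  classical
  let S : Submodule ℝ (Mat n) :=
    { carrier := {e | e.IsSymm}
      add_mem' := fun ha hb => Matrix.IsSymm.add ha hb
      zero_mem' := Matrix.isSymm_zero
      smul_mem' := fun c _ hx => Matrix.IsSymm.smul hx c }
  let T : Mat n →ₗ[ℝ] Mat n :=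
    { toFun := tensorApply C
      map_add' := by
        intro a b
        ext i j
        simp [tensorApply, mul_add, Finset.sum_add_distrib]
      map_smul' := by
        intro c a
        ext i j
        simp only [tensorApply, Matrix.of_apply, Matrix.smul_apply, smul_eq_mul, RingHom.id_apply,
          Finset.mul_sum]
        refine Finset.sum_congr rfl fun k _ => Finset.sum_congr rfl fun l _ => ?_
        ring }
  have hT : ∀ e ∈ S, T e ∈ S := by
    intro e _
    change (tensorApply C e).IsSymm
    ext i j
    simp only [tensorApply, Matrix.transpose_apply, Matrix.of_apply]
    refine Finset.sum_congr rfl fun k _ => Finset.sum_congr rfl fun l _ => ?_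
    rw [hC.symm_left]
  have hinj : ∀ e : Mat n, e.IsSymm → tensorApply C e = 0 → e = 0 := by
    intro e he h0
    obtain ⟨c, hc, hpos⟩ := hC.pos
    have h1 := hpos e
    have h2 : symPart e = e := by
      ext i j
      have : e j i = e i j := he.apply i j
      simp [symPart, this]
      ring
    rw [h0, h2] at h1
    have h3 : ddot (0 : Mat n) e = 0 := by simp [ddot]
    rw [h3] at h1
    have h4 : ddot e e ≤ 0 := by
      by_contra hcon
      have := mul_pos hc (not_le.mp hcon)
      linarith
    ext i j
    have h5 : e i j * e i j ≤ ddot e e := by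
      refine le_trans ?_ (Finset.single_le_sum (f := fun i => ∑ j, e i j * e i j)
        (fun i _ => Finset.sum_nonneg fun j _ => mul_self_nonneg _) (Finset.mem_univ i))
      exact Finset.single_le_sum (f := fun j => e i j * e i j)
        (fun j _ => mul_self_nonneg _) (Finset.mem_univ j)
    have h6 : e i j * e i j = 0 := le_antisymm (h5.trans h4) (mul_self_nonneg _)
    simpa using h6
  let R : S →ₗ[ℝ] S := T.restrict hT
  have hR : Function.Injective R := by
    rw [injective_iff_map_eq_zero]
    intro e he
    apply Subtype.ext
    exact hinj e.1 e.2 (congrArg Subtype.val he)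
  obtain ⟨e, he⟩ := LinearMap.surjective_of_injective hR ⟨s, hs⟩
  refine ⟨e.1, ⟨e.2, congrArg Subtype.val he⟩, ?_⟩
  rintro e' ⟨hs', he'⟩
  have : R ⟨e', hs'⟩ = R e := by
    rw [he]
    exact Subtype.ext he'
  exact congrArg Subtype.val (hR this)

/-! ### Domains and cracks -/

/-- Lipschitz boundary: near every boundary point, `Ω` is the region strictly above the graph of a
Lipschitz function of the coordinates orthogonal to some unit vector `e`. -/
def HasLipschitzBoundary (Ω : Set (Vec n)) : Prop :=
  ∀ x ∈ frontier Ω, ∃ (e : Vec n) (f : Vec n → ℝ) (L : ℝ≥0) (U : Set (Vec n)),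
    ‖e‖ = 1 ∧ LipschitzWith L f ∧ (∀ (y : Vec n) (t : ℝ), f (y + t • e) = f y) ∧
    IsOpen U ∧ x ∈ U ∧ Ω ∩ U = {y | f y < inner ℝ e y} ∩ U

/-- Countably rectifiable sets of dimension `n - 1`: `ℋⁿ⁻¹`-almost all of `K` is covered by
countably many Lipschitz images of `ℝⁿ⁻¹`. -/
def IsCountablyRectifiable (K : Set (Vec n)) : Prop :=
  ∃ f : ℕ → Vec (n - 1) → Vec n, (∀ m, ∃ L : ℝ≥0, LipschitzWith L (f m)) ∧
    Measure.hausdorffMeasure ((n : ℝ) - 1) (K \ ⋃ m, range (f m)) = 0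

/-- The measure `μ = ℒⁿ + ℋⁿ⁻¹⌞K`. -/
noncomputable def crackMeasure (K : Set (Vec n)) : Measure (Vec n) :=
  volume + (Measure.hausdorffMeasure ((n : ℝ) - 1)).restrict K

/-! ### Sobolev spaces with respect to a measure -/

/-- The partial derivative `∂φ/∂xⱼ` of a smooth scalar function. -/
noncomputable def pderiv (j : Fin n) (φ : Vec n → ℝ) (x : Vec n) : ℝ :=
  fderiv ℝ φ x (EuclideanSpace.single j 1)

/-- Test functions: `φ ∈ C_c^∞(U)`. -/
def IsTest (U : Set (Vec n)) (φ : Vec n → ℝ) : Prop :=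
  ContDiff ℝ ∞ φ ∧ HasCompactSupport φ ∧ tsupport φ ⊆ U

/-- `u ∈ L¹(U, ℝⁿ)`, and the distributional derivative `Du` of `u` on `U` is the matrix-valued
measure `G μ` with `G ∈ L¹(μ)`; that is, `u ∈ BV(U, ℝⁿ)`, `|Du| ≪ μ` and `Du/μ = G`. -/
structure IsDerivDensity (U : Set (Vec n)) (μ : Measure (Vec n)) (u : Vec n → Vec n)
    (G : Vec n → Mat n) : Prop where
  integrable : IntegrableOn u U volume
  integrable_density : ∀ i j, IntegrableOn (fun x => G x i j) U μ
  deriv_eq : ∀ φ : Vec n → ℝ, IsTest U φ → ∀ i j,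
    ∫ x in U, u x i * pderiv j φ x = - ∫ x in U, φ x * G x i j ∂μ

/-- `u ∈ W^{1,p}_μ(U, ℝⁿ)`: `u ∈ BV(U, ℝⁿ)`, `|Du| ≪ μ` and `Du/μ ∈ L^p(μ)`. -/
def MemW (p : ℝ≥0∞) (U : Set (Vec n)) (μ : Measure (Vec n)) (u : Vec n → Vec n) : Prop :=
  ∃ G : Vec n → Mat n, IsDerivDensity U μ u G ∧
    ∀ i j, MemLp (fun x => G x i j) p (μ.restrict U)

open Classical in
/-- The density `Du/μ` (unique `μ`-almost everywhere on an open `U`). If `μ = ℒⁿ` this is the weak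
gradient; if `μ = ℒⁿ + ℋⁿ⁻¹⌞K` with `ℋⁿ⁻¹(K) < ∞`, then `ℒⁿ(K) = 0`, so it agrees `ℒⁿ`-almost
everywhere with `∇u`, the density of the absolutely continuous part of `Du`, and on `K` it is
`[u] ⊗ n`. -/
noncomputable def derivDensity (U : Set (Vec n)) (μ : Measure (Vec n)) (u : Vec n → Vec n) :
    Vec n → Mat n :=
  if h : ∃ G : Vec n → Mat n, IsDerivDensity U μ u G then h.choose else 0

/-- The classical Sobolev space `W^{1,2}(U, ℝⁿ)` on a bounded open set `U` (where `L² ⊆ L¹`). -/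
def MemSobolev (U : Set (Vec n)) (w : Vec n → Vec n) : Prop :=
  MemLp w 2 (volume.restrict U) ∧ MemW 2 U volume w

/-! ### Boundary values -/

/-- The boundary term of the Gauss-Green formula,
`∫_U uᵢ ∂ⱼφ dx + ∫_U φ d(Du)ᵢⱼ`, for `Du = (Du/μ) μ` and `φ ∈ C_c^∞(ℝⁿ)`.
If `U` is bounded with Lipschitz boundary and `u ∈ BV(U, ℝⁿ)`, it equals
`∫_{∂U} φ uᵢ nⱼ dℋⁿ⁻¹`, with the trace of `u` and the exterior unit normal `n`. -/
noncomputable def boundaryTerm (U : Set (Vec n)) (μ : Measure (Vec n)) (u : Vec n → Vec n)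
    (φ : Vec n → ℝ) (i j : Fin n) : ℝ :=
  (∫ x in U, u x i * pderiv j φ x) + ∫ x in U, φ x * derivDensity U μ u x i j ∂μ

/-- `u = v` on `∂U` in the sense of traces, for `u` and `v` of bounded variation with `Du ≪ μ` and
`Dv ≪ ν`: the boundary terms of the two functions in the Gauss-Green formula coincide
(equivalently, the extension of `u - v` by zero does not charge `∂U` with any derivative). -/
def SameTrace (U : Set (Vec n)) (μ : Measure (Vec n)) (u : Vec n → Vec n)
    (ν : Measure (Vec n)) (v : Vec n → Vec n) : Prop :=
  ∀ φ : Vec n → ℝ, IsTest univ φ → ∀ i j, boundaryTerm U μ u φ i j = boundaryTerm U ν v φ i j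

/-- The space `W^{1,2}_μ(Ω, ℝⁿ, u₀)` of all `u ∈ W^{1,2}_μ(Ω, ℝⁿ)` with `u = u₀` on `∂Ω`. -/
def MemWBoundary (Ω : Set (Vec n)) (μ : Measure (Vec n)) (u₀ u : Vec n → Vec n) : Prop :=
  MemW 2 Ω μ u ∧ SameTrace Ω μ u μ u₀

/-! ### Energy and minimizers -/

/-- `F(u) = (1/2) ∫_Ω C ∇u : ∇u dx`, for `u ∈ W^{1,2}_μ(Ω, ℝⁿ)` with `μ = ℒⁿ + ℋⁿ⁻¹⌞K`. -/
noncomputable def energy (C : Fin n → Fin n → Fin n → Fin n → ℝ) (Ω K : Set (Vec n))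
    (u : Vec n → Vec n) : ℝ :=
  1 / 2 * ∫ x in Ω, ddot (tensorApply C (derivDensity Ω (crackMeasure K) u x))
    (derivDensity Ω (crackMeasure K) u x)

/-- `u` minimizes `F` over `W^{1,2}_μ(Ω, ℝⁿ, u₀)`, where `μ = ℒⁿ + ℋⁿ⁻¹⌞K`. -/
def IsMinimizer (C : Fin n → Fin n → Fin n → Fin n → ℝ) (Ω K : Set (Vec n))
    (u₀ u : Vec n → Vec n) : Prop :=
  MemWBoundary Ω (crackMeasure K) u₀ u ∧
    ∀ v : Vec n → Vec n, MemWBoundary Ω (crackMeasure K) u₀ v → energy C Ω K u ≤ energy C Ω K v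

/-! ### Admissible stresses -/

/-- The space `Y_K(Ω)` of admissible stresses: symmetric square integrable matrix fields with
`div σ = 0` in the sense of distributions on `Ω` and `σ n = 0` on `K`.

As `σ` is only square integrable, its normal trace on the two faces of `K` is the functional
`φ ↦ ∫ σ : ∇φ dx + ∫ div σ · φ dx` given by Green's formula on the cracked body `Ω \ K`, where
`φ ∈ W^{1,2}(Ω \ K, ℝⁿ)` may jump across `K` and vanishes near `∂Ω`. Here `div σ = 0`. -/
structure IsAdmissibleStress (Ω K : Set (Vec n)) (σ : Vec n → Mat n) : Prop where
  symm : ∀ᵐ x ∂(volume.restrict Ω), (σ x).IsSymm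
  memLp : ∀ i j, MemLp (fun x => σ x i j) 2 (volume.restrict Ω)
  div_eq_zero : ∀ φ : Vec n → ℝ, IsTest Ω φ → ∀ i, ∫ x in Ω, ∑ j, σ x i j * pderiv j φ x = 0
  normal_eq_zero : ∀ φ : Vec n → Vec n, MemSobolev (Ω \ K) φ →
    (∃ S : Set (Vec n), IsCompact S ∧ S ⊆ Ω ∧ ∀ x ∉ S, φ x = 0) →
    ∫ x in Ω \ K, ddot (σ x) (derivDensity (Ω \ K) volume φ x) = 0

/-- `∫_{∂Ω} (σ n) · g dℋⁿ⁻¹ = t`, for `σ ∈ L²` with `div σ = 0` on `Ω` and a function `g` (of bounded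
variation, with `Dg ≪ μ`) whose trace on `∂Ω` is the trace of a `W^{1,2}(Ω, ℝⁿ)` function.

The normal trace `σ n` is an element of the dual of `H^{1/2}(∂Ω, ℝⁿ)`, and the integral is the
duality pairing: its value is `∫_Ω σ : ∇w dx + ∫_Ω div σ · w dx = ∫_Ω σ : ∇w dx` for every
`w ∈ W^{1,2}(Ω, ℝⁿ)` with `w = g` on `∂Ω`. Both the existence of such `w` and the independence of
the choice of `w` are part of this assertion. -/
def IsNormalTracePairing (Ω : Set (Vec n)) (μ : Measure (Vec n)) (σ : Vec n → Mat n)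
    (g : Vec n → Vec n) (t : ℝ) : Prop :=
  (∃ w : Vec n → Vec n, MemSobolev Ω w ∧ SameTrace Ω volume w μ g) ∧
    ∀ w : Vec n → Vec n, MemSobolev Ω w → SameTrace Ω volume w μ g →
      ∫ x in Ω, ddot (σ x) (derivDensity Ω volume w x) = t

end CrackedBody

namespace CrackedBody

open Filter Topology Convolution ContinuousLinearMap

variable {n : ℕ}

/-! ### Translations and mollifications -/

/-! With `e = C⁻¹σ`, expanding `½ C(z - e) : (z - e) ≥ 0` gives the pointwise Fenchel inequality `σ
: z - ½ C⁻¹σ : σ ≤ ½ Cz : z` (`ddot_sub_half_tensorInv_le`). Taking `z = ∇u` and integrating proves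
the bound with `∫ σ : ∇u` in place of the boundary pairing.

It remains to see that `∫ σ : ∇u = ∫ σ : ∇w` for every Sobolev `w` with the trace of `u₀`
(`integral_mul_eq_zero_of_sameTrace`). Extended by zero, each component of `u - w` has a weak
gradient on the complement of `K`: equality of traces excludes a singular part on `∂Ω`, so jumps
remain on `K` only. A partition of unity splits this function. Pieces supported inside `Ω` are
handled by `σ n = 0` on `K`. Pieces near `∂Ω` do not meet `K`; moved slightly into `Ω` and
mollified, they become test functions for `div σ = 0`.

The gradient is in `L²`, but `u` itself is only known to be in `L¹`, whereas the condition on `K` is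
tested with `L²` functions. The truncations `M sin(v / M)` of `HasWeakGrad.sin` bridge this gap as
`M → ∞`.

A Sobolev `w` with the trace of `u₀` is `(1 - η) u₀`, with a cutoff `η` equal to 1 on `K`
(`exists_memSobolev_sameTrace`). Boundedness of `u₀` puts the term `u₀ ∇η` in `L²`. -/

theorem tendsto_eLpNorm_translate_sub {q : ℝ≥0∞} [hq : Fact (1 ≤ q)] (hq' : q ≠ ⊤)
    {g : Vec n → ℝ} (hg : MemLp g q volume) :
    Tendsto (fun z : Vec n => eLpNorm (fun x => g (x - z) - g x) q volume) (𝓝 0) (𝓝 0) := by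
  let τ : Vec n → C(Vec n, Vec n) :=
    fun z => ⟨fun x => x - z, by fun_prop⟩
  -- Translations depend continuously on `z` in the compact-open topology; for finite `q`,
  -- composition of a fixed `L^q` function with measure preserving maps is continuous in the map.
  have hτ : Continuous τ :=
    ContinuousMap.continuous_of_continuous_uncurry _ (continuous_snd.sub continuous_fst)
  have hmp : ∀ z, MeasurePreserving (τ z) (volume : Measure (Vec n)) volume :=
    fun z => measurePreserving_sub_right volume z
  have hc : Continuous fun z => Lp.compMeasurePreserving (τ z) (hmp z) (hg.toLp g) :=
    (continuous_const (y := hg.toLp g)).compMeasurePreservingLp hτ hmp hq'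
  have h0 : Lp.compMeasurePreserving (τ 0) (hmp 0) (hg.toLp g) = hg.toLp g := by
    apply Lp.ext
    filter_upwards [Lp.coeFn_compMeasurePreserving (hg.toLp g) (hmp 0)] with x hx
    rw [hx]
    exact congrArg _ (sub_zero x)
  have h1 := tendsto_iff_edist_tendsto_0.1 (hc.tendsto 0)
  refine h1.congr fun z => ?_
  rw [h0, Lp.edist_def]
  refine eLpNorm_congr_ae ?_
  have h2 := (hmp z).quasiMeasurePreserving.ae_eq_comp hg.coeFn_toLp
  filter_upwards [Lp.coeFn_compMeasurePreserving (hg.toLp g) (hmp z), h2, hg.coeFn_toLp]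
    with x hx h2x hgx
  rw [Pi.sub_apply, hx, h2x, hgx]
  rfl

theorem abs_integral_mul_le_eLpNorm {α : Type*} [MeasurableSpace α] {μ : Measure α}
    {p q : ℝ≥0∞} [p.HolderTriple q 1] {a h : α → ℝ}
    (ha : MemLp a p μ) (hh : MemLp h q μ) :
    ENNReal.ofReal |∫ x, a x * h x ∂μ| ≤ eLpNorm a p μ * eLpNorm h q μ := by
  have h1 := eLpNorm_smul_le_mul_eLpNorm (p := p) (q := q) (r := 1) hh.1 ha.1
  refine le_trans ?_ h1
  rw [eLpNorm_one_eq_lintegral_enorm, ← Real.norm_eq_abs, ofReal_norm]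
  exact enorm_integral_le_lintegral_enorm _

/-- By Fubini, and since `ρ` has mass one, the difference is the `ρ`-average over `z` of `∫ a(x)
(g(x - z) - g(x)) dx`; Hölder bounds each of these integrals. -/
theorem abs_integral_mul_convolution_sub_le {p q : ℝ≥0∞} [p.HolderTriple q 1]
    {a g ρ : Vec n → ℝ} (ha : MemLp a p volume) (hg : MemLp g q volume)
    (hρ : Integrable ρ volume) (hρ0 : ∀ z, 0 ≤ ρ z) (hρ1 : ∫ z, ρ z = 1) {δ : ℝ≥0∞}
    (hδ : ∀ z, ρ z ≠ 0 → eLpNorm (fun x => g (x - z) - g x) q volume ≤ δ) :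
    ENNReal.ofReal |(∫ x, a x * (g ⋆[lsmul ℝ ℝ, volume] ρ) x) - ∫ x, a x * g x|
      ≤ eLpNorm a p volume * δ := by
  have hmp (z : Vec n) : MeasurePreserving (fun x => x - z) (volume : Measure (Vec n)) volume :=
    measurePreserving_sub_right volume z
  have hgz (z : Vec n) : MemLp (fun x => g (x - z)) q volume :=
    hg.comp_measurePreserving (hmp z)
  have hnorm (z : Vec n) : eLpNorm (fun x => g (x - z)) q volume = eLpNorm g q volume :=
    eLpNorm_comp_measurePreserving hg.1 (hmp z)
  have hint (z : Vec n) : Integrable (fun x => a x * g (x - z)) volume :=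
    ha.integrable_mul (hgz z)
  have hmeas : AEStronglyMeasurable (fun w : Vec n × Vec n => a w.1 * (g (w.1 - w.2) * ρ w.2))
      (volume.prod volume) := by
    refine ha.1.comp_fst.mul (AEStronglyMeasurable.mul ?_ hρ.1.comp_snd)
    exact hg.1.comp_quasiMeasurePreserving
      (quasiMeasurePreserving_sub (G := Vec n) volume volume)
  have hprod : Integrable (fun w : Vec n × Vec n => a w.1 * (g (w.1 - w.2) * ρ w.2))
      (volume.prod volume) := by
    rw [integrable_prod_iff' hmeas]
    refine ⟨ae_of_all _ fun z => ?_, ?_⟩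
    · simpa [mul_assoc] using (hint z).mul_const (ρ z)
    · refine Integrable.mono' (hρ.mul_const (eLpNorm a p volume * eLpNorm g q volume).toReal)
        hmeas.norm.prod_swap.integral_prod_right' (ae_of_all _ fun z => ?_)
      have h1 : ∀ x, ‖a x * (g (x - z) * ρ z)‖ = ρ z * (‖a x‖ * ‖g (x - z)‖) := fun x => by
        rw [norm_mul, norm_mul, Real.norm_of_nonneg (hρ0 z)]; ring
      simp only [h1, integral_const_mul]
      rw [norm_mul, Real.norm_of_nonneg (hρ0 z)]
      refine mul_le_mul_of_nonneg_left ?_ (hρ0 z)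
      have h2 := abs_integral_mul_le_eLpNorm ha.norm (hgz z).norm
      rw [eLpNorm_norm, eLpNorm_norm, hnorm] at h2
      exact (ENNReal.ofReal_le_iff_le_toReal (ENNReal.mul_ne_top ha.2.ne hg.2.ne)).1 h2
  have hswap : ∫ x, a x * (g ⋆[lsmul ℝ ℝ, volume] ρ) x
      = ∫ z, ρ z * ∫ x, a x * g (x - z) := by
    have h1 : ∀ x, a x * (g ⋆[lsmul ℝ ℝ, volume] ρ) x = ∫ z, a x * (g (x - z) * ρ z) := by
      intro x
      rw [convolution_eq_swap, integral_const_mul]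
      rfl
    simp_rw [h1]
    rw [integral_integral_swap hprod]
    refine integral_congr_ae (ae_of_all _ fun z => ?_)
    simp only
    rw [← integral_const_mul]
    congr 1
    ext x
    ring
  have hH : Integrable (fun z => ρ z * ∫ x, a x * g (x - z)) volume := by
    refine hprod.swap.integral_prod_left.congr (ae_of_all _ fun z => ?_)
    simp only [Function.comp, Prod.swap]
    rw [← integral_const_mul]
    congr 1
    ext x
    ring
  by_cases htop : eLpNorm a p volume * δ = ⊤
  · rw [htop]; exact le_top
  have hb : ∀ z, ‖ρ z * (∫ x, a x * g (x - z)) - ρ z * ∫ x, a x * g x‖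
      ≤ ρ z * (eLpNorm a p volume * δ).toReal := by
    intro z
    rw [← mul_sub, norm_mul, Real.norm_of_nonneg (hρ0 z)]
    by_cases hz : ρ z = 0
    · simp [hz]
    refine mul_le_mul_of_nonneg_left ?_ (hρ0 z)
    have h0 := hint 0
    simp only [sub_zero] at h0
    rw [← integral_sub (hint z) h0]
    simp only [← mul_sub]
    refine (ENNReal.ofReal_le_iff_le_toReal htop).1 ?_
    exact (abs_integral_mul_le_eLpNorm ha ((hgz z).sub hg)).trans (by gcongr; exact hδ z hz)
  rw [hswap, ← one_mul (∫ x, a x * g x), ← hρ1, ← integral_mul_const,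
    ← integral_sub hH (hρ.mul_const _)]
  refine (ENNReal.ofReal_le_iff_le_toReal htop).2 ?_
  refine (norm_integral_le_of_norm_le (hρ.mul_const _) (ae_of_all _ hb)).trans ?_
  rw [integral_mul_const, hρ1, one_mul]

/-- Mollified functions converge weakly, even when tested with bounded sequences. -/
theorem tendsto_integral_mul_convolution_sub {p q : ℝ≥0∞} [p.HolderTriple q 1] [Fact (1 ≤ q)]
    (hq : q ≠ ⊤) {a ρ : ℕ → Vec n → ℝ} {g : Vec n → ℝ} (ha : ∀ k, MemLp (a k) p volume)
    {M : ℝ≥0∞} (hM : M ≠ ⊤) (haM : ∀ k, eLpNorm (a k) p volume ≤ M) (hg : MemLp g q volume)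
    (hρ : ∀ k, Integrable (ρ k) volume) (hρ0 : ∀ k z, 0 ≤ ρ k z) (hρ1 : ∀ k, ∫ z, ρ k z = 1)
    (hsupp : Tendsto (fun k => Function.support (ρ k)) atTop (𝓝 (0 : Vec n)).smallSets) :
    Tendsto (fun k => (∫ x, a k x * (g ⋆[lsmul ℝ ℝ, volume] ρ k) x) - ∫ x, a k x * g x)
      atTop (𝓝 0) := by
  rw [tendsto_zero_iff_norm_tendsto_zero, Metric.tendsto_nhds]
  intro ε hε
  have hε' : ENNReal.ofReal ε ≠ 0 := by simpa using hε
  obtain ⟨δ, hδ0, hδ⟩ : ∃ δ : ℝ≥0∞, 0 < δ ∧ M * δ < ENNReal.ofReal ε := by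
    have h1 : Tendsto (fun δ : ℝ≥0∞ => M * δ) (𝓝 0) (𝓝 0) := by
      simpa using ENNReal.Tendsto.const_mul (tendsto_id (α := ℝ≥0∞) (x := 𝓝 0)) (Or.inr hM)
    have h2 := (h1.eventually (gt_mem_nhds (pos_iff_ne_zero.2 hε')))
    have h3 : ∃ᶠ δ in 𝓝 (0 : ℝ≥0∞), 0 < δ := by
      have : (𝓝[>] (0 : ℝ≥0∞)).NeBot := inferInstance
      exact (frequently_nhdsWithin_iff.1 (Frequently.of_forall (f := 𝓝[>] (0 : ℝ≥0∞))
        (p := fun _ => True) (fun _ => trivial))).mono fun x hx => hx.2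
    obtain ⟨δ, h4, h5⟩ := (h3.and_eventually h2).exists
    exact ⟨δ, h4, h5⟩
  have h1 := (tendsto_eLpNorm_translate_sub hq hg).eventually (gt_mem_nhds hδ0)
  have h2 := tendsto_smallSets_iff.1 hsupp _ h1
  filter_upwards [h2] with k hk
  have h3 := abs_integral_mul_convolution_sub_le (ha k) hg (hρ k) (hρ0 k) (hρ1 k) (δ := δ)
    (fun z hz => (hk hz).le)
  rw [Real.dist_0_eq_abs, abs_norm, Real.norm_eq_abs]
  refine (ENNReal.ofReal_lt_ofReal_iff hε).1 (h3.trans_lt (lt_of_le_of_lt ?_ hδ))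
  gcongr
  exact haM k

/-! ### Partial derivatives and test functions -/

theorem continuous_pderiv {φ : Vec n → ℝ} (hφ : ContDiff ℝ ∞ φ) (j : Fin n) :
    Continuous (pderiv j φ) :=
  (hφ.continuous_fderiv (by simp)).clm_apply continuous_const

theorem pderiv_mul {φ ψ : Vec n → ℝ} (hφ : ContDiff ℝ ∞ φ) (hψ : ContDiff ℝ ∞ ψ) (j : Fin n)
    (x : Vec n) :
    pderiv j (fun y => φ y * ψ y) x = φ x * pderiv j ψ x + ψ x * pderiv j φ x := by
  simp only [pderiv]
  rw [fderiv_fun_mul (hφ.differentiable (by simp) x) (hψ.differentiable (by simp) x)]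
  simp

theorem IsTest.mono {U V : Set (Vec n)} {φ : Vec n → ℝ} (h : IsTest U φ) (hUV : U ⊆ V) :
    IsTest V φ :=
  ⟨h.1, h.2.1, h.2.2.trans hUV⟩

theorem IsTest.mul_left {U : Set (Vec n)} {φ χ : Vec n → ℝ} (h : IsTest U φ)
    (hχ : ContDiff ℝ ∞ χ) {V : Set (Vec n)} (hV : tsupport χ ∩ U ⊆ V) :
    IsTest V (fun x => χ x * φ x) :=
  ⟨hχ.mul h.1, h.2.1.mul_left, fun _ hx =>
    hV ⟨tsupport_mul_subset_left hx, h.2.2 (tsupport_mul_subset_right hx)⟩⟩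

theorem IsTest.continuous {U : Set (Vec n)} {φ : Vec n → ℝ} (h : IsTest U φ) : Continuous φ :=
  h.1.continuous

theorem IsTest.hasCompactSupport_pderiv {U : Set (Vec n)} {φ : Vec n → ℝ} (h : IsTest U φ)
    (j : Fin n) : HasCompactSupport (pderiv j φ) :=
  h.2.1.fderiv_apply (𝕜 := ℝ) _

theorem IsTest.exists_bound {U : Set (Vec n)} {φ : Vec n → ℝ} (h : IsTest U φ) :
    ∃ C, ∀ x, ‖φ x‖ ≤ C :=
  h.2.1.exists_bound_of_continuous h.continuous

theorem IsTest.exists_bound_pderiv {U : Set (Vec n)} {φ : Vec n → ℝ} (h : IsTest U φ)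
    (j : Fin n) : ∃ C, ∀ x, ‖pderiv j φ x‖ ≤ C :=
  (h.hasCompactSupport_pderiv j).exists_bound_of_continuous (continuous_pderiv h.1 j)

theorem IsTest.integrable_mul {U : Set (Vec n)} {φ : Vec n → ℝ} (h : IsTest U φ)
    {μ : Measure (Vec n)} {f : Vec n → ℝ} (hf : Integrable f μ) :
    Integrable (fun x => φ x * f x) μ := by
  obtain ⟨C, hC⟩ := h.exists_bound
  exact hf.bdd_mul h.continuous.aestronglyMeasurable (ae_of_all _ hC)

theorem IsTest.integrable_mul_pderiv {U : Set (Vec n)} {φ : Vec n → ℝ} (h : IsTest U φ)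
    {μ : Measure (Vec n)} {f : Vec n → ℝ} (hf : Integrable f μ) (j : Fin n) :
    Integrable (fun x => f x * pderiv j φ x) μ := by
  obtain ⟨C, hC⟩ := h.exists_bound_pderiv j
  exact hf.mul_bdd (continuous_pderiv h.1 j).aestronglyMeasurable (ae_of_all _ hC)

/-! ### Weak gradients of scalar functions -/

/-- `v ∈ L¹(ℝⁿ)` has the weak gradient `g ∈ L¹(ℝⁿ, ℝⁿ)` on the set `O`. -/
structure HasWeakGrad (O : Set (Vec n)) (v : Vec n → ℝ) (g : Fin n → Vec n → ℝ) : Prop where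
  integrable : Integrable v volume
  integrable_grad : ∀ j, Integrable (g j) volume
  integral_eq : ∀ φ : Vec n → ℝ, IsTest O φ → ∀ j,
    ∫ x, v x * pderiv j φ x = - ∫ x, φ x * g j x

/-- Leibniz rule, obtained by testing with `χ φ`. The new set `O'` may be larger than `O`: only the
part of it that meets the support of `χ` matters, so a localized function can acquire a weak
gradient on all of `ℝⁿ`. -/
theorem HasWeakGrad.mul_left {O O' : Set (Vec n)} {v : Vec n → ℝ} {g : Fin n → Vec n → ℝ}
    (h : HasWeakGrad O v g) {χ : Vec n → ℝ} (hχ : IsTest univ χ) (hO : tsupport χ ∩ O' ⊆ O) :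
    HasWeakGrad O' (fun x => χ x * v x) (fun j x => χ x * g j x + v x * pderiv j χ x) := by
  refine ⟨hχ.integrable_mul h.integrable, fun j => (hχ.integrable_mul (h.integrable_grad j)).add
    (hχ.integrable_mul_pderiv h.integrable j), fun φ hφ j => ?_⟩
  have h1 := h.integral_eq _ (hφ.mul_left hχ.1 hO) j
  have hi1 := hχ.integrable_mul (hφ.integrable_mul_pderiv h.integrable j)
  have hi2 := hφ.integrable_mul (hχ.integrable_mul_pderiv h.integrable j)
  have hi3 := hφ.integrable_mul (hχ.integrable_mul (h.integrable_grad j))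
  have e1 : ∫ x, v x * pderiv j (fun y => χ y * φ y) x
      = (∫ x, χ x * (v x * pderiv j φ x)) + ∫ x, φ x * (v x * pderiv j χ x) := by
    rw [← integral_add hi1 hi2]
    refine integral_congr_ae (ae_of_all _ fun x => ?_)
    simp only [pderiv_mul hχ.1 hφ.1]
    ring
  have e2 : ∫ x, φ x * (χ x * g j x + v x * pderiv j χ x)
      = (∫ x, φ x * (χ x * g j x)) + ∫ x, φ x * (v x * pderiv j χ x) := by
    rw [← integral_add hi3 hi2]
    refine integral_congr_ae (ae_of_all _ fun x => ?_)
    simp only []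
    ring
  have e3 : ∫ x, χ x * φ x * g j x = ∫ x, φ x * (χ x * g j x) :=
    integral_congr_ae (ae_of_all _ fun x => by simp only []; ring)
  have e4 : ∫ x, χ x * v x * pderiv j φ x = ∫ x, χ x * (v x * pderiv j φ x) :=
    integral_congr_ae (ae_of_all _ fun x => by simp only []; ring)
  rw [e2, e4]
  rw [e1, e3] at h1
  linarith

/-! ### Mollification of weak gradients and the chain rule. -/

/-- The derivative falls on `ρ`, and `t ↦ ρ (x - t)` is a test function on `O`, so the definition of
the weak gradient moves it back to `v`. The sign from differentiating `x - t` cancels the one from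
integration by parts. -/
theorem HasWeakGrad.pderiv_convolution {O : Set (Vec n)} {v : Vec n → ℝ} {g : Fin n → Vec n → ℝ}
    (h : HasWeakGrad O v g) {ρ : Vec n → ℝ} (hρ : IsTest univ ρ) {x : Vec n}
    (hx : ∀ z ∈ tsupport ρ, x - z ∈ O) (j : Fin n) :
    pderiv j (v ⋆[lsmul ℝ ℝ, volume] ρ) x = (g j ⋆[lsmul ℝ ℝ, volume] ρ) x := by
  have h1 := hρ.2.1.hasFDerivAt_convolution_right (lsmul ℝ ℝ) h.integrable.locallyIntegrable
    (hρ.1.of_le (by simp)) x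
  rw [pderiv, h1.fderiv]
  rw [convolution_precompR_apply (lsmul ℝ ℝ) h.integrable.locallyIntegrable
    (hρ.2.1.fderiv (𝕜 := ℝ)) (hρ.1.continuous_fderiv (by simp))]
  have hd : ContDiff ℝ ∞ (fun t : Vec n => ρ (x - t)) := hρ.1.comp (contDiff_const.sub contDiff_id)
  have hts : tsupport (fun t : Vec n => ρ (x - t)) ⊆ (fun t => x - t) ⁻¹' tsupport ρ :=
    tsupport_comp_subset_preimage ρ (f := fun t : Vec n => x - t) (by fun_prop)
  have ht : IsTest O (fun t : Vec n => ρ (x - t)) := by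
    refine ⟨hd, ?_, fun t ht => ?_⟩
    · exact hρ.2.1.comp_homeomorph (Homeomorph.subLeft x)
    · simpa using hx _ (hts ht)
  have h2 := h.integral_eq _ ht j
  have h3 : ∀ t, pderiv j (fun t : Vec n => ρ (x - t)) t = - pderiv j ρ (x - t) := by
    intro t
    have := (hρ.1.differentiable (by simp) (x - t)).hasFDerivAt.comp t
      ((hasFDerivAt_id t).const_sub x)
    have h4 : fderiv ℝ (fun t : Vec n => ρ (x - t)) t = _ := this.fderiv
    rw [pderiv, h4]
    simp [pderiv]
  simp only [h3, mul_neg, integral_neg, neg_inj] at h2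
  rw [convolution_def, convolution_def]
  simp only [lsmul_apply, smul_eq_mul]
  rw [show (∫ t, g j t * ρ (x - t)) = ∫ t, ρ (x - t) * g j t from
    integral_congr_ae (ae_of_all _ fun t => mul_comm _ _), ← h2]
  rfl

/-- The support of the convolution lies in the compact set `S + B`. Since `B` need not be centred at
the origin, `S` is allowed to touch `∂Ω`. -/
theorem isTest_convolution {Ω S B : Set (Vec n)} {v ρ : Vec n → ℝ} (hv : Integrable v volume)
    (hρ : IsTest univ ρ) (hS : IsCompact S) (hB : IsCompact B) (hvS : Function.support v ⊆ S)
    (hρB : Function.support ρ ⊆ B) (hSB : ∀ y ∈ S, ∀ z ∈ B, y + z ∈ Ω) :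
    IsTest Ω (v ⋆[lsmul ℝ ℝ, volume] ρ) := by
  have hsub : Function.support (v ⋆[lsmul ℝ ℝ, volume] ρ) ⊆ (fun p : Vec n × Vec n => p.1 + p.2) ''
      (S ×ˢ B) := by
    refine (support_convolution_subset (lsmul ℝ ℝ)).trans ?_
    rintro _ ⟨y, hy, z, hz, rfl⟩
    exact ⟨(y, z), ⟨hvS hy, hρB hz⟩, rfl⟩
  have hc : IsCompact ((fun p : Vec n × Vec n => p.1 + p.2) '' (S ×ˢ B)) :=
    (hS.prod hB).image (by fun_prop)
  refine ⟨hρ.2.1.contDiff_convolution_right _ hv.locallyIntegrable hρ.1,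
    HasCompactSupport.of_support_subset_isCompact hc hsub, ?_⟩
  refine (closure_minimal hsub hc.isClosed).trans ?_
  rintro _ ⟨p, hp, rfl⟩
  exact hSB _ hp.1 _ hp.2

theorem isTest_normed_bump (b : ContDiffBump (0 : Vec n)) (c : Vec n) :
    IsTest univ (fun x => b.normed volume (x - c)) :=
  ⟨b.contDiff_normed.comp (contDiff_id.sub contDiff_const),
    b.hasCompactSupport_normed.comp_homeomorph (Homeomorph.subRight c), subset_univ _⟩

/-- A divergence free field on `Ω` is orthogonal to the weak gradients on `ℝⁿ` of functions whose
support can be moved into `Ω` by small translations in a cone around `e`. -/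
theorem HasWeakGrad.integral_sum_eq_zero_of_translate {Ω : Set (Vec n)} {τ : Fin n → Vec n → ℝ}
    (hτ : ∀ j, MemLp (τ j) 2 volume)
    (hdiv : ∀ φ : Vec n → ℝ, IsTest Ω φ → ∑ j, ∫ x, τ j x * pderiv j φ x = 0)
    {v : Vec n → ℝ} {g : Fin n → Vec n → ℝ} (h : HasWeakGrad univ v g)
    (hg : ∀ j, MemLp (g j) 2 volume) {S : Set (Vec n)} (hS : IsCompact S)
    (hvS : Function.support v ⊆ S) {e : Vec n} {c ε₀ : ℝ} (hc : 0 < c) (hε₀ : 0 < ε₀)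
    (hcone : ∀ ε, 0 < ε → ε < ε₀ → ∀ y ∈ S, ∀ z ∈ Metric.closedBall (ε • e) (c * ε), y + z ∈ Ω) :
    ∑ j, ∫ x, τ j x * g j x = 0 := by
  obtain ⟨ε, -, hεm, hεlim⟩ := exists_seq_strictAnti_tendsto' hε₀
  have hε : ∀ k, 0 < ε k := fun k => (hεm k).1
  let b : ℕ → ContDiffBump (0 : Vec n) := fun k =>
    ⟨c * ε k / 2, c * ε k, half_pos (mul_pos hc (hε k)), half_lt_self (mul_pos hc (hε k))⟩
  -- Centring the bump at `ε k • e` makes the convolution mollify and translate inwards at once; the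
  -- outer radius `c * ε k` is the one allowed by `hcone`.
  let ρ : ℕ → Vec n → ℝ := fun k x => (b k).normed volume (x - ε k • e)
  have htest : ∀ k, IsTest univ (ρ k) := fun k => isTest_normed_bump _ _
  have hball : ∀ k, Function.support (ρ k) ⊆ Metric.closedBall (ε k • e) (c * ε k) := by
    intro k x hx
    have h1 : x - ε k • e ∈ Function.support ((b k).normed volume) := hx
    rw [ContDiffBump.support_normed_eq, mem_ball_zero_iff] at h1
    rw [mem_closedBall_iff_norm]
    exact h1.le
  have hsupp : Tendsto (fun k => Function.support (ρ k)) atTop (𝓝 (0 : Vec n)).smallSets := by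
    rw [tendsto_smallSets_iff]
    intro t ht
    obtain ⟨r, hr, hrt⟩ := Metric.mem_nhds_iff.1 ht
    have h1 : Tendsto (fun k => ε k * ‖e‖ + c * ε k) atTop (𝓝 0) := by
      simpa using (hεlim.mul_const ‖e‖).add (hεlim.const_mul c)
    filter_upwards [h1.eventually (gt_mem_nhds hr)] with k hk
    intro x hx
    apply hrt
    have h2 := mem_closedBall_iff_norm.1 (hball k hx)
    rw [mem_ball_zero_iff]
    have h3 : ‖x‖ ≤ ‖x - ε k • e‖ + ‖ε k • e‖ := by
      simpa using norm_add_le (x - ε k • e) (ε k • e)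
    rw [norm_smul, Real.norm_of_nonneg (hε k).le] at h3
    linarith
  have hconv : ∀ j, Tendsto (fun k => ∫ x, τ j x * pderiv j (v ⋆[lsmul ℝ ℝ, volume] ρ k) x)
      atTop (𝓝 (∫ x, τ j x * g j x)) := by
    intro j
    have h1 := tendsto_integral_mul_convolution_sub (p := 2) (q := 2) (by simp)
      (a := fun _ => τ j) (ρ := ρ) (fun _ => hτ j) (hτ j).2.ne (fun _ => le_rfl) (hg j)
      (fun k => (htest k).continuous.integrable_of_hasCompactSupport (htest k).2.1)
      (fun k z => (b k).nonneg_normed _)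
      (fun k => by
        rw [← (b k).integral_normed (μ := volume)]
        exact integral_sub_right_eq_self (μ := volume) ((b k).normed volume) (ε k • e)) hsupp
    rw [tendsto_sub_nhds_zero_iff] at h1
    refine h1.congr fun k => ?_
    refine integral_congr_ae (ae_of_all _ fun x => ?_)
    simp only []
    rw [h.pderiv_convolution (htest k) (fun _ _ => mem_univ _)]
  have hz : ∀ k, ∑ j, ∫ x, τ j x * pderiv j (v ⋆[lsmul ℝ ℝ, volume] ρ k) x = 0 := fun k =>
    hdiv _ (isTest_convolution h.integrable (htest k) hS (isCompact_closedBall _ _) hvS (hball k)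
      (hcone _ (hε k) (hεm k).2))
  have h2 := tendsto_finsetSum Finset.univ fun j _ => hconv j
  simp only [hz] at h2
  exact (tendsto_nhds_unique h2 tendsto_const_nhds)

/-- Chain rule for the bounded truncations `t ↦ M sin (t / M)`. -/
theorem HasWeakGrad.sin {O : Set (Vec n)} (hO : IsOpen O) {v : Vec n → ℝ} {g : Fin n → Vec n → ℝ}
    (h : HasWeakGrad O v g) {M : ℝ} (hM : 0 < M) :
    HasWeakGrad O (fun x => M * Real.sin (v x / M)) (fun j x => Real.cos (v x / M) * g j x) := by
  have hvm : AEStronglyMeasurable v volume := h.integrable.1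
  have hsm : AEStronglyMeasurable (fun x => M * Real.sin (v x / M)) volume :=
    (by fun_prop : Continuous fun t : ℝ => M * Real.sin (t / M)).comp_aestronglyMeasurable hvm
  have hcm : AEStronglyMeasurable (fun x => Real.cos (v x / M)) volume :=
    (by fun_prop : Continuous fun t : ℝ => Real.cos (t / M)).comp_aestronglyMeasurable hvm
  refine ⟨?_, fun j => ?_, fun φ hφ j => ?_⟩
  · refine h.integrable.norm.mono' hsm (ae_of_all _ fun x => ?_)
    rw [norm_mul, Real.norm_of_nonneg hM.le, Real.norm_eq_abs]
    calc M * |Real.sin (v x / M)| ≤ M * |v x / M| := by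
          exact mul_le_mul_of_nonneg_left Real.abs_sin_le_abs hM.le
      _ = ‖v x‖ := by
          rw [abs_div, abs_of_pos hM, Real.norm_eq_abs]; field_simp
  · exact (h.integrable_grad j).bdd_mul hcm
      (ae_of_all _ fun x => by simpa using Real.abs_cos_le_one _)
  -- Mollifying at scales below `δ` uses only values in `O` when evaluated on the support of `φ`.
  obtain ⟨δ, hδ, hδO⟩ := hφ.2.1.isCompact.exists_cthickening_subset_open hO hφ.2.2
  obtain ⟨ε, -, hεm, hεlim⟩ := exists_seq_strictAnti_tendsto' hδ
  have hε : ∀ k, 0 < ε k := fun k => (hεm k).1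
  let b : ℕ → ContDiffBump (0 : Vec n) := fun k =>
    ⟨ε k / 2, ε k, half_pos (hε k), half_lt_self (hε k)⟩
  let ρ : ℕ → Vec n → ℝ := fun k => (b k).normed volume
  have htest : ∀ k, IsTest univ (ρ k) := fun k => by simpa using isTest_normed_bump (b k) 0
  let V : ℕ → Vec n → ℝ := fun k => v ⋆[lsmul ℝ ℝ, volume] ρ k
  have hVs : ∀ k, ContDiff ℝ ∞ (V k) := fun k =>
    (htest k).2.1.contDiff_convolution_right _ h.integrable.locallyIntegrable (htest k).1
  have hVv : ∀ᵐ x, Tendsto (fun k => V k x) atTop (𝓝 (v x)) := by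
    have h1 := ContDiffBump.ae_convolution_tendsto_right_of_locallyIntegrable (μ := volume)
      (φ := b) (K := 2) (l := atTop) hεlim
      (Eventually.of_forall fun k => by change ε k ≤ 2 * (ε k / 2); linarith)
      h.integrable.locallyIntegrable
    filter_upwards [h1] with x hx
    refine hx.congr fun k => ?_
    have h2 := congrFun (convolution_flip (f := v) (g := ρ k) (L := lsmul ℝ ℝ) (μ := volume)) x
    simp only [V]
    rw [← h2]
    simp only [convolution_def, lsmul_apply, flip_apply, smul_eq_mul, ρ]
    exact integral_congr_ae (ae_of_all _ fun t => mul_comm _ _)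
  have hVd : ∀ k, ∀ x ∈ tsupport φ, pderiv j (V k) x = (g j ⋆[lsmul ℝ ℝ, volume] ρ k) x := by
    intro k x hx
    refine h.pderiv_convolution (htest k) (fun z hz => hδO ?_) j
    rw [(b k).tsupport_normed_eq, mem_closedBall_zero_iff] at hz
    refine Metric.mem_cthickening_of_dist_le (x - z) x δ _ hx ?_
    rw [dist_eq_norm]
    simpa using hz.trans (hεm k).2.le
  have hparts : ∀ k, ∫ x, (M * Real.sin (V k x / M)) * pderiv j φ x
      = - ∫ x, (φ x * Real.cos (V k x / M)) * (g j ⋆[lsmul ℝ ℝ, volume] ρ k) x := by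
    intro k
    have hT : ContDiff ℝ ∞ fun x => M * Real.sin (V k x / M) :=
      contDiff_const.mul (Real.contDiff_sin.comp ((hVs k).div_const M))
    have hd : ∀ x, fderiv ℝ (fun x => M * Real.sin (V k x / M)) x (EuclideanSpace.single j 1)
        = Real.cos (V k x / M) * pderiv j (V k) x := by
      intro x
      have h1 := ((((hVs k).differentiable (by simp) x).hasFDerivAt.mul_const (M⁻¹)).sin).const_mul M
      have h2 : fderiv ℝ (fun x => M * Real.sin (V k x * M⁻¹)) x = _ := h1.fderiv
      simp only [div_eq_mul_inv]
      rw [h2]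
      simp only [pderiv, FunLike.coe_smul, Pi.smul_apply, smul_eq_mul]
      field_simp
    have hTd : Continuous fun x =>
        fderiv ℝ (fun x => M * Real.sin (V k x / M)) x (EuclideanSpace.single j 1) :=
      continuous_pderiv hT j
    have h1 := integral_mul_fderiv_eq_neg_fderiv_mul_of_integrable (μ := volume)
      (f := fun x => M * Real.sin (V k x / M)) (g := φ) (v := EuclideanSpace.single j 1)
      ((hTd.mul hφ.continuous).integrable_of_hasCompactSupport hφ.2.1.mul_left)
      ((hT.continuous.mul (continuous_pderiv hφ.1 j)).integrable_of_hasCompactSupport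
        (hφ.hasCompactSupport_pderiv j).mul_left)
      ((hT.continuous.mul hφ.continuous).integrable_of_hasCompactSupport hφ.2.1.mul_left)
      (fun x _ => hT.differentiable (by simp) x) (fun x _ => hφ.1.differentiable (by simp) x)
    refine h1.trans (congrArg Neg.neg (integral_congr_ae (ae_of_all _ fun x => ?_)))
    simp only [hd]
    by_cases hx : x ∈ tsupport φ
    · rw [hVd k x hx]; ring
    · rw [image_eq_zero_of_notMem_tsupport hx]; ring
  obtain ⟨C, hC⟩ := hφ.exists_bound
  have hlim1 : Tendsto (fun k => ∫ x, (M * Real.sin (V k x / M)) * pderiv j φ x) atTop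
      (𝓝 (∫ x, (M * Real.sin (v x / M)) * pderiv j φ x)) := by
    refine tendsto_integral_of_dominated_convergence (fun x => M * ‖pderiv j φ x‖)
      (fun k => ?_) ?_ (fun k => ae_of_all _ fun x => ?_) ?_
    · have := (hVs k).continuous
      have := continuous_pderiv hφ.1 j
      exact Continuous.aestronglyMeasurable (by fun_prop)
    · exact ((continuous_pderiv hφ.1 j).integrable_of_hasCompactSupport
        (hφ.hasCompactSupport_pderiv j)).norm.const_mul M
    · rw [norm_mul, norm_mul, Real.norm_of_nonneg hM.le]
      gcongr
      exact mul_le_of_le_one_right hM.le (by simpa using Real.abs_sin_le_one _)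
    · filter_upwards [hVv] with x hx
      exact ((Real.continuous_sin.tendsto _).comp (hx.div_const M)).const_mul M |>.mul_const _
  have hlim2 : Tendsto (fun k => ∫ x, (φ x * Real.cos (V k x / M)) * g j x) atTop
      (𝓝 (∫ x, (φ x * Real.cos (v x / M)) * g j x)) := by
    refine tendsto_integral_of_dominated_convergence (fun x => C * ‖g j x‖)
      (fun k => ?_) ((h.integrable_grad j).norm.const_mul C) (fun k => ae_of_all _ fun x => ?_) ?_
    · have := (hVs k).continuous
      have := hφ.continuous
      exact (Continuous.aestronglyMeasurable (by fun_prop)).mul (h.integrable_grad j).1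
    · rw [norm_mul, norm_mul]
      gcongr
      exact (mul_le_of_le_one_right (norm_nonneg _)
        (by simpa using Real.abs_cos_le_one _)).trans (hC x)
    · filter_upwards [hVv] with x hx
      exact (((Real.continuous_cos.tendsto _).comp (hx.div_const M)).const_mul _).mul_const _
  have hac : ∀ k, Continuous fun x => φ x * Real.cos (V k x / M) := fun k => by
    have := (hVs k).continuous
    have := hφ.continuous
    fun_prop
  have haC : ∀ k x, ‖φ x * Real.cos (V k x / M)‖ ≤ C := fun k x => by
    rw [norm_mul]
    exact (mul_le_of_le_one_right (norm_nonneg _)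
        (by simpa using Real.abs_cos_le_one _)).trans (hC x)
  -- Both factors vary with `k` and `g j` is only in `L¹` here. The bounded factor is the varying
  -- weight `a k`, with exponents `∞` and `1`; this replaces the mollified gradient by `g j`, after
  -- which `hlim2` applies.
  have hlim3 := tendsto_integral_mul_convolution_sub (p := ⊤) (q := 1) (by simp)
    (a := fun k x => φ x * Real.cos (V k x / M)) (ρ := ρ) (M := ENNReal.ofReal C) (g := g j)
    (fun k => memLp_top_of_bound (hac k).aestronglyMeasurable C (ae_of_all _ (haC k)))
    (by simp) (fun k => eLpNormEssSup_le_of_ae_bound (ae_of_all _ (haC k)))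
    (memLp_one_iff_integrable.2 (h.integrable_grad j))
    (fun k => (htest k).continuous.integrable_of_hasCompactSupport (htest k).2.1)
    (fun k z => (b k).nonneg_normed _) (fun k => (b k).integral_normed)
    (ContDiffBump.tendsto_support_normed_smallSets hεlim)
  have hlim4 := (hlim3.add hlim2).neg
  simp only [sub_add_cancel, zero_add, ← hparts] at hlim4
  rw [tendsto_nhds_unique hlim1 hlim4]
  refine congrArg Neg.neg (integral_congr_ae (ae_of_all _ fun x => ?_))
  simp only []
  ring

/-! ### Localization at the boundary and removal of the `L²` assumption on the function. -/

/-- Near a Lipschitz boundary point, `Ω` contains the translates of compact pieces of its closure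
by vectors in a small cone. -/
theorem exists_cone_translate_mem {Ω U S : Set (Vec n)} {e : Vec n} {f : Vec n → ℝ} {L : ℝ≥0}
    (he : ‖e‖ = 1) (hf : LipschitzWith L f) (hfe : ∀ (y : Vec n) (t : ℝ), f (y + t • e) = f y)
    (hU : IsOpen U) (hΩU : Ω ∩ U = {y | f y < inner ℝ e y} ∩ U) (hS : IsCompact S)
    (hSU : S ⊆ U) (hSΩ : S ⊆ closure Ω) :
    ∃ c ε₀ : ℝ, 0 < c ∧ 0 < ε₀ ∧ ∀ ε, 0 < ε → ε < ε₀ → ∀ y ∈ S,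
      ∀ z ∈ Metric.closedBall (ε • e) (c * ε), y + z ∈ Ω := by
  obtain ⟨δ, hδ, hδU⟩ := hS.exists_cthickening_subset_open hU hSU
  have hL : (0 : ℝ) ≤ L := L.2
  -- Moving by `z` raises `f` by at most `L c ε` and the height `⟨e, y⟩` by at least `ε - c ε`. As
  -- `(L + 1) c = 1/2`, a margin `ε / 2` remains, which makes the inequality strict even for `y` on
  -- the boundary. Since `c ≤ 1`, `‖z‖ ≤ 2 ε < δ` keeps `y + z` in `U`.
  set c : ℝ := 1 / (2 * (L + 1)) with hc
  have hc0 : 0 < c := by positivity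
  have hcL : (L + 1) * c = 1 / 2 := by rw [hc]; field_simp
  have hc1 : c ≤ 1 := by nlinarith
  refine ⟨c, δ / 2, hc0, half_pos hδ, fun ε hε hεδ y hy z hz => ?_⟩
  rw [mem_closedBall_iff_norm] at hz
  have hyz : y + z ∈ U := by
    refine hδU (Metric.mem_cthickening_of_dist_le _ y δ _ hy ?_)
    have h1 : ‖z‖ ≤ ‖z - ε • e‖ + ‖ε • e‖ := by simpa using norm_add_le (z - ε • e) (ε • e)
    rw [norm_smul, he, Real.norm_of_nonneg hε.le] at h1
    rw [dist_eq_norm, add_sub_cancel_left]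
    nlinarith
  have hy1 : f y ≤ inner ℝ e y := by
    have h1 : y ∈ closure (Ω ∩ U) := by
      have := hU.inter_closure ⟨hSU hy, hSΩ hy⟩
      rwa [inter_comm]
    have hcl : IsClosed {y | f y ≤ inner ℝ e y} :=
      isClosed_le hf.continuous (by fun_prop)
    refine closure_minimal ?_ hcl h1
    rw [hΩU]
    exact fun w hw => (show f w < inner ℝ e w from hw.1).le
  -- `f` does not see the displacement `ε • e`; only the remainder `z - ε • e`, of norm at most `c *
  -- ε`, counts.
  have h2 : f (y + z) ≤ f y + L * (c * ε) := by
    have h3 : f (y + z) = f (y + (z - ε • e)) := by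
      rw [← hfe (y + (z - ε • e)) ε]
      congr 1
      abel
    have h4 := hf.dist_le_mul (y + (z - ε • e)) y
    rw [dist_eq_norm, dist_eq_norm, add_sub_cancel_left, Real.norm_eq_abs] at h4
    have h5 := (le_abs_self _).trans (h4.trans (mul_le_mul_of_nonneg_left hz hL))
    linarith
  have h3 : inner ℝ e y + ε - c * ε ≤ inner ℝ e (y + z) := by
    have h4 : inner ℝ e (y + z) = inner ℝ e y + ε + inner ℝ e (z - ε • e) := by
      rw [inner_add_right, inner_sub_right, inner_smul_right, real_inner_self_eq_norm_sq, he]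
      ring
    have h5 := abs_real_inner_le_norm e (z - ε • e)
    rw [he, one_mul] at h5
    have h6 := (abs_le.1 (h5.trans hz)).1
    linarith
  have : y + z ∈ Ω ∩ U := by
    rw [hΩU]
    refine ⟨?_, hyz⟩
    change f (y + z) < inner ℝ e (y + z)
    nlinarith
  exact this.1

theorem IsTest.memLp_mul {U : Set (Vec n)} {χ : Vec n → ℝ} (h : IsTest U χ) {f : Vec n → ℝ}
    {p : ℝ≥0∞} {μ : Measure (Vec n)} (hf : MemLp f p μ) : MemLp (fun x => χ x * f x) p μ := by
  obtain ⟨C, hC⟩ := h.exists_bound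
  refine hf.of_le_mul (c := C) (h.continuous.aestronglyMeasurable.mul hf.1) (ae_of_all _ fun x => ?_)
  rw [norm_mul]
  gcongr
  exact hC x

theorem IsTest.memLp_mul_pderiv {U : Set (Vec n)} {χ : Vec n → ℝ} (h : IsTest U χ)
    {f : Vec n → ℝ} {p : ℝ≥0∞} {μ : Measure (Vec n)} (hf : MemLp f p μ) (j : Fin n) :
    MemLp (fun x => f x * pderiv j χ x) p μ := by
  obtain ⟨C, hC⟩ := h.exists_bound_pderiv j
  refine hf.of_le_mul (c := C) (hf.1.mul (continuous_pderiv h.1 j).aestronglyMeasurable)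
    (ae_of_all _ fun x => ?_)
  rw [norm_mul, mul_comm]
  gcongr
  exact hC x

/-- Passes from local statements to global ones: compactness gives a finite cover by sets with
property `P`, and their boundedness makes the subordinate partition functions compactly supported.
-/
theorem exists_finite_partition {s : Set (Vec n)} (hs : IsCompact s)
    {P : Set (Vec n) → Prop} (h : ∀ x ∈ s, ∃ U, IsOpen U ∧ Bornology.IsBounded U ∧ x ∈ U ∧ P U) :
    ∃ (ι : Type) (_ : Fintype ι) (χ : ι → Vec n → ℝ), (∀ i, IsTest univ (χ i)) ∧
      (∀ i, ∃ U, P U ∧ tsupport (χ i) ⊆ U) ∧ ∀ x ∈ s, ∑ i, χ i x = 1 := by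
  choose! U hUo hUb hxU hPU using h
  obtain ⟨t, hts, hst⟩ := hs.elim_nhds_subcover U fun x hx => (hUo x hx).mem_nhds (hxU x hx)
  let φ := t.equivFin.symm
  obtain ⟨f, hf⟩ := SmoothPartitionOfUnity.exists_isSubordinate (modelWithCornersSelf ℝ (Vec n))
    hs.isClosed (fun i : Fin t.card => U (φ i)) (fun i => hUo _ (hts _ (φ i).2)) (by
      intro x hx
      obtain ⟨y, hy, hxy⟩ := mem_iUnion₂.1 (hst hx)
      exact mem_iUnion.2 ⟨t.equivFin ⟨y, hy⟩, by simpa [φ] using hxy⟩)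
  refine ⟨Fin t.card, inferInstance, fun i => f i, fun i => ⟨(f i).contMDiff.contDiff, ?_,
    subset_univ _⟩, fun i => ⟨U (φ i), hPU _ (hts _ (φ i).2), hf i⟩, fun x hx => ?_⟩
  · exact Metric.isCompact_of_isClosed_isBounded (isClosed_tsupport _)
      ((hUb _ (hts _ (φ i).2)).subset (hf i))
  · rw [← finsum_eq_sum_of_fintype]
    exact f.sum_eq_one hx

/-- A divergence free field on `Ω` whose normal trace vanishes on both faces of `K` is orthogonal to
the weak gradients on `Kᶜ` of square integrable functions vanishing outside `Ω`. -/
theorem HasWeakGrad.integral_sum_eq_zero_of_memLp {Ω K : Set (Vec n)} (hΩ : IsOpen Ω)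
    (hΩb : Bornology.IsBounded Ω) (hΩL : HasLipschitzBoundary Ω) (hKc : IsClosed K) (hKΩ : K ⊆ Ω)
    {τ : Fin n → Vec n → ℝ} (hτ : ∀ j, MemLp (τ j) 2 volume)
    (hdiv : ∀ φ : Vec n → ℝ, IsTest Ω φ → ∑ j, ∫ x, τ j x * pderiv j φ x = 0)
    (hnormal : ∀ (v : Vec n → ℝ) (g : Fin n → Vec n → ℝ), HasWeakGrad (Ω \ K) v g →
      MemLp v 2 volume → (∀ j, MemLp (g j) 2 volume) → (∃ S, IsCompact S ∧ S ⊆ Ω ∧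
        (∀ x ∉ S, v x = 0) ∧ ∀ j, ∀ x ∉ S, g j x = 0) → ∑ j, ∫ x, τ j x * g j x = 0)
    {v : Vec n → ℝ} {g : Fin n → Vec n → ℝ} (h : HasWeakGrad Kᶜ v g) (hv : MemLp v 2 volume)
    (hg : ∀ j, MemLp (g j) 2 volume) (hvΩ : ∀ x ∉ Ω, v x = 0) (hgΩ : ∀ j, ∀ x ∉ Ω, g j x = 0) :
    ∑ j, ∫ x, τ j x * g j x = 0 := by
  have hmem : ∀ χ : Vec n → ℝ, IsTest univ χ → ∀ j,
      MemLp (fun x => χ x * g j x + v x * pderiv j χ x) 2 volume := fun χ hχ j =>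
    (hχ.memLp_mul (hg j)).add (hχ.memLp_mul_pderiv hv j)
  have hloc : ∀ x ∈ closure Ω, ∃ U, IsOpen U ∧ Bornology.IsBounded U ∧ x ∈ U ∧
      ∀ χ : Vec n → ℝ, IsTest univ χ → tsupport χ ⊆ U →
        ∑ j, ∫ x, τ j x * (χ x * g j x + v x * pderiv j χ x) = 0 := by
    intro x hx
    -- Inside `Ω` a cut-off function may jump across `K` and is tested by `hnormal`. At a boundary
    -- point the neighbourhood is chosen disjoint from `K`, so the cut-off function has a weak
    -- gradient on all of `ℝⁿ` and `hdiv` suffices.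
    by_cases hxΩ : x ∈ Ω
    · refine ⟨Ω, hΩ, hΩb, hxΩ, fun χ hχ hχΩ => ?_⟩
      refine hnormal _ _ (h.mul_left hχ (fun y hy => hy.2.2)) (hχ.memLp_mul hv) (hmem χ hχ)
        ⟨tsupport χ, hχ.2.1, hχΩ, fun y hy => ?_, fun j y hy => ?_⟩
      · simp [image_eq_zero_of_notMem_tsupport hy]
      · have h1 : pderiv j χ y = 0 := by
          rw [pderiv, image_eq_zero_of_notMem_tsupport fun h2 => hy (tsupport_fderiv_subset ℝ h2)]
          simp
        simp [image_eq_zero_of_notMem_tsupport hy, h1]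
    · have hxf : x ∈ frontier Ω := ⟨hx, by rwa [hΩ.interior_eq]⟩
      obtain ⟨e, f, L, U, he, hf, hfe, hU, hxU, hΩU⟩ := hΩL x hxf
      refine ⟨U ∩ Kᶜ ∩ Metric.ball x 1, (hU.inter hKc.isOpen_compl).inter Metric.isOpen_ball,
        Metric.isBounded_ball.subset inter_subset_right,
        ⟨⟨hxU, fun hk => hxΩ (hKΩ hk)⟩, Metric.mem_ball_self one_pos⟩, fun χ hχ hχU => ?_⟩
      have hS : IsCompact (tsupport χ ∩ closure Ω) := hχ.2.1.isCompact.inter_right isClosed_closure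
      obtain ⟨c, ε₀, hc, hε₀, hcone⟩ := exists_cone_translate_mem he hf hfe hU hΩU hS
        (fun y hy => (hχU hy.1).1.1) inter_subset_right
      refine (h.mul_left hχ (O' := univ) (fun y hy => (hχU hy.1).1.2)
        ).integral_sum_eq_zero_of_translate hτ hdiv (hmem χ hχ) hS (fun y hy => ?_) hc hε₀ hcone
      refine ⟨subset_tsupport _ (left_ne_zero_of_mul hy), subset_closure ?_⟩
      by_contra hyΩ
      exact right_ne_zero_of_mul hy (hvΩ y hyΩ)
  obtain ⟨ι, _, χ, hχ, hχU, hsum⟩ := exists_finite_partition hΩb.isCompact_closure hloc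
  have hzero : ∀ i, ∑ j, ∫ x, τ j x * (χ i x * g j x + v x * pderiv j (χ i) x) = 0 := fun i => by
    obtain ⟨U, hU, hsU⟩ := hχU i
    exact hU _ (hχ i) hsU
  -- In `Ω` the cutoffs sum to 1 near `x`, so their derivatives sum to 0. Off `Ω` that may fail, but
  -- there `v` and `g` vanish.
  have hpt : ∀ j x, ∑ i, (χ i x * g j x + v x * pderiv j (χ i) x) = g j x := by
    intro j x
    by_cases hx : x ∈ Ω
    · have h1 : ∑ i, pderiv j (χ i) x = 0 := by
        have h2 : (fun y => ∑ i, χ i y) =ᶠ[𝓝 x] fun _ => (1 : ℝ) := by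
          filter_upwards [hΩ.mem_nhds hx] with y hy using hsum y (subset_closure hy)
        have h3 := h2.fderiv_eq (𝕜 := ℝ)
        rw [fderiv_fun_sum (fun i _ => (hχ i).1.differentiable (by simp) x)] at h3
        have h4 := congrArg (fun A => A (EuclideanSpace.single j 1)) h3
        simpa [pderiv] using h4
      rw [Finset.sum_add_distrib, ← Finset.sum_mul, ← Finset.mul_sum, h1,
        hsum x (subset_closure hx)]
      ring
    · simp [hvΩ x hx, hgΩ j x hx]
  have hswap : ∀ j, ∫ x, τ j x * g j x
      = ∑ i, ∫ x, τ j x * (χ i x * g j x + v x * pderiv j (χ i) x) := by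
    intro j
    have hi : ∀ i, Integrable (fun x => τ j x * (χ i x * g j x + v x * pderiv j (χ i) x)) volume :=
      fun i => (hτ j).integrable_mul (hmem _ (hχ i) j)
    rw [← integral_finsetSum _ fun i _ => hi i]
    refine integral_congr_ae (ae_of_all _ fun x => ?_)
    simp only []
    rw [← Finset.mul_sum, hpt]
  simp_rw [hswap]
  rw [Finset.sum_comm]
  exact Finset.sum_eq_zero fun i _ => hzero i

/-- The same for integrable functions with square integrable gradient. -/
theorem HasWeakGrad.integral_sum_eq_zero {Ω K : Set (Vec n)} (hΩ : IsOpen Ω)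
    (hΩb : Bornology.IsBounded Ω) (hΩL : HasLipschitzBoundary Ω) (hKc : IsClosed K) (hKΩ : K ⊆ Ω)
    {τ : Fin n → Vec n → ℝ} (hτ : ∀ j, MemLp (τ j) 2 volume)
    (hdiv : ∀ φ : Vec n → ℝ, IsTest Ω φ → ∑ j, ∫ x, τ j x * pderiv j φ x = 0)
    (hnormal : ∀ (v : Vec n → ℝ) (g : Fin n → Vec n → ℝ), HasWeakGrad (Ω \ K) v g →
      MemLp v 2 volume → (∀ j, MemLp (g j) 2 volume) → (∃ S, IsCompact S ∧ S ⊆ Ω ∧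
        (∀ x ∉ S, v x = 0) ∧ ∀ j, ∀ x ∉ S, g j x = 0) → ∑ j, ∫ x, τ j x * g j x = 0)
    {v : Vec n → ℝ} {g : Fin n → Vec n → ℝ} (h : HasWeakGrad Kᶜ v g)
    (hg : ∀ j, MemLp (g j) 2 volume) (hvΩ : ∀ x ∉ Ω, v x = 0) (hgΩ : ∀ j, ∀ x ∉ Ω, g j x = 0) :
    ∑ j, ∫ x, τ j x * g j x = 0 := by
  have hcm : ∀ M : ℝ, AEStronglyMeasurable (fun x => Real.cos (v x / M)) volume := fun M =>
    (by fun_prop : Continuous fun t : ℝ => Real.cos (t / M)).comp_aestronglyMeasurable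
      h.integrable.1
  have hcg : ∀ M j, MemLp (fun x => Real.cos (v x / M) * g j x) 2 volume := fun M j => by
    refine (hg j).of_le ((hcm M).mul (hg j).1) (ae_of_all _ fun x => ?_)
    rw [norm_mul]
    exact mul_le_of_le_one_left (norm_nonneg _) (by simpa using Real.abs_cos_le_one _)
  -- The truncation at level `k + 1` is bounded and integrable, hence in `L²`. Its gradient carries
  -- the factor `cos(v / (k + 1))`, which is at most 1 in modulus and tends to 1, so dominated
  -- convergence removes the truncation.
  have hz : ∀ k : ℕ, ∑ j, ∫ x, τ j x * (Real.cos (v x / ((k : ℝ) + 1)) * g j x) = 0 := by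
    intro k
    have hM : (0 : ℝ) < (k : ℝ) + 1 := by positivity
    have hs := h.sin hKc.isOpen_compl hM
    refine hs.integral_sum_eq_zero_of_memLp hΩ hΩb hΩL hKc hKΩ hτ hdiv hnormal ?_ (hcg _)
      (fun x hx => by simp [hvΩ x hx]) (fun j x hx => by simp [hgΩ j x hx])
    rw [memLp_two_iff_integrable_sq hs.integrable.1]
    simp only [sq]
    refine hs.integrable.bdd_mul (c := (k : ℝ) + 1) hs.integrable.1 (ae_of_all _ fun x => ?_)
    rw [norm_mul, Real.norm_of_nonneg hM.le]
    exact mul_le_of_le_one_right hM.le (by simpa using Real.abs_sin_le_one _)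
  have hlim : ∀ j, Tendsto (fun k : ℕ => ∫ x, τ j x * (Real.cos (v x / ((k : ℝ) + 1)) * g j x))
      atTop (𝓝 (∫ x, τ j x * g j x)) := by
    intro j
    refine tendsto_integral_of_dominated_convergence (fun x => ‖τ j x * g j x‖)
      (fun k => (hτ j).1.mul ((hcm _).mul (hg j).1)) ((hτ j).integrable_mul (hg j)).norm
      (fun k => ae_of_all _ fun x => ?_) (ae_of_all _ fun x => ?_)
    · rw [norm_mul, norm_mul, norm_mul]
      refine mul_le_mul_of_nonneg_left ?_ (norm_nonneg _)
      exact mul_le_of_le_one_left (norm_nonneg _) (by simpa using Real.abs_cos_le_one _)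
    · have h1 : Tendsto (fun k : ℕ => v x / ((k : ℝ) + 1)) atTop (𝓝 0) :=
        tendsto_const_nhds.div_atTop
          (tendsto_atTop_add_const_right _ _ tendsto_natCast_atTop_atTop)
      have h2 := ((Real.continuous_cos.tendsto 0).comp h1).mul_const (g j x) |>.const_mul (τ j x)
      simpa using h2
  have h2 := tendsto_finsetSum Finset.univ fun j _ => hlim j
  simp only [hz] at h2
  exact (tendsto_nhds_unique h2 tendsto_const_nhds)

/-! ### The measure `ℒⁿ + ℋⁿ⁻¹⌞K` and derivative densities -/

/-- Finite `ℋⁿ⁻¹` measure forces `ℋⁿ(K) = 0`, and Lebesgue measure is absolutely continuous with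
respect to `ℋⁿ`. -/
theorem volume_eq_zero_of_hausdorffMeasure_lt_top {K : Set (Vec n)}
    (hK : Measure.hausdorffMeasure ((n : ℝ) - 1) K < ⊤) : volume K = 0 := by
  have h1 : Measure.hausdorffMeasure (n : ℝ) K = 0 :=
    (Measure.hausdorffMeasure_zero_or_top (sub_one_lt (n : ℝ)) K).resolve_right hK.ne
  have h2 : (volume : Measure (Vec n)) ≪ Measure.hausdorffMeasure (Module.finrank ℝ (Vec n) : ℝ) :=
    Measure.absolutelyContinuous_isAddHaarMeasure _ _
  rw [finrank_euclideanSpace_fin] at h2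
  exact h2 h1

theorem volume_le_crackMeasure (K : Set (Vec n)) : volume ≤ crackMeasure K :=
  Measure.le_add_right le_rfl

theorem integral_crackMeasure {Ω K : Set (Vec n)} (hK : MeasurableSet K)
    {f : Vec n → ℝ} (hf : IntegrableOn f Ω (crackMeasure K)) (h0 : ∀ x ∈ K, f x = 0) :
    ∫ x in Ω, f x ∂(crackMeasure K) = ∫ x in Ω, f x := by
  have h1 : (crackMeasure K).restrict Ω = volume.restrict Ω +
      ((Measure.hausdorffMeasure ((n : ℝ) - 1)).restrict K).restrict Ω := Measure.restrict_add _ _ _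
  rw [IntegrableOn, h1] at hf
  rw [h1, integral_add_measure hf.left_of_add_measure hf.right_of_add_measure]
  have h2 : ∀ᵐ x ∂(((Measure.hausdorffMeasure ((n : ℝ) - 1)).restrict K).restrict Ω), f x = 0 :=
    ae_restrict_of_ae ((ae_restrict_iff' hK).2 (ae_of_all _ h0))
  rw [integral_eq_zero_of_ae h2, add_zero]

theorem MemW.isDerivDensity {p : ℝ≥0∞} {U : Set (Vec n)} {μ : Measure (Vec n)} {u : Vec n → Vec n}
    (h : MemW p U μ u) : IsDerivDensity U μ u (derivDensity U μ u) := by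
  obtain ⟨G, hG, -⟩ := h
  have h1 : ∃ G : Vec n → Mat n, IsDerivDensity U μ u G := ⟨G, hG⟩
  rw [derivDensity, dif_pos h1]
  exact h1.choose_spec

theorem IsDerivDensity.integrable_apply {U : Set (Vec n)} {μ : Measure (Vec n)}
    {u : Vec n → Vec n} {G : Vec n → Mat n} (h : IsDerivDensity U μ u G) (i : Fin n) :
    IntegrableOn (fun x => u x i) U volume :=
  (EuclideanSpace.proj (𝕜 := ℝ) i : Vec n →L[ℝ] ℝ).integrable_comp h.integrable

/-- Fundamental lemma of the calculus of variations. `derivDensity` is an arbitrary choice, and this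
uniqueness transfers to it what is known for one particular density. -/
theorem IsDerivDensity.ae_eq {U : Set (Vec n)} (hU : IsOpen U) {u : Vec n → Vec n}
    {G G' : Vec n → Mat n} (h : IsDerivDensity U volume u G) (h' : IsDerivDensity U volume u G') :
    G =ᵐ[volume.restrict U] G' := by
  have h1 : ∀ i j, ∀ᵐ x ∂(volume.restrict U), G x i j = G' x i j := by
    intro i j
    have hd := (h.integrable_density i j).sub (h'.integrable_density i j)
    have h2 := hU.ae_eq_zero_of_integral_contDiff_smul_eq_zero (μ := volume)
      hd.locallyIntegrableOn (fun φ hφ hφc hφU => by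
        have ht : IsTest U φ := ⟨hφ, hφc, hφU⟩
        have e1 := h.deriv_eq φ ht i j
        rw [h'.deriv_eq φ ht i j, neg_inj] at e1
        have e2 : ∫ x in U, φ x * (G x i j - G' x i j) = 0 := by
          simp only [mul_sub]
          rw [integral_sub (ht.integrable_mul (h.integrable_density i j))
            (ht.integrable_mul (h'.integrable_density i j)), e1, sub_self]
        rw [← e2]
        symm
        refine setIntegral_eq_integral_of_forall_compl_eq_zero fun x hx => ?_
        rw [image_eq_zero_of_notMem_tsupport fun hh => hx (hφU hh), zero_mul])
    rw [ae_restrict_iff' hU.measurableSet]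
    filter_upwards [h2] with x hx hxU
    exact sub_eq_zero.1 (hx hxU)
  have h2 : ∀ᵐ x ∂(volume.restrict U), ∀ i j, G x i j = G' x i j :=
    ae_all_iff.2 fun i => ae_all_iff.2 (h1 i)
  filter_upwards [h2] with x hx
  ext i j
  exact hx i j

theorem restrict_diff_null {Ω K : Set (Vec n)} (hK0 : volume K = 0) :
    (volume : Measure (Vec n)).restrict (Ω \ K) = volume.restrict Ω :=
  Measure.restrict_congr_set (sdiff_null_ae_eq_self hK0)

/-- Away from the crack, the density with respect to `ℒⁿ + ℋⁿ⁻¹⌞K` is the weak gradient. -/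
theorem IsDerivDensity.diff {Ω K : Set (Vec n)} (hK : MeasurableSet K) (hK0 : volume K = 0)
    {u : Vec n → Vec n} {G : Vec n → Mat n} (h : IsDerivDensity Ω (crackMeasure K) u G) :
    IsDerivDensity (Ω \ K) volume u G := by
  refine ⟨h.integrable.mono_set sdiff_subset, fun i j => ?_, fun φ hφ i j => ?_⟩
  · exact ((h.integrable_density i j).mono_measure (volume_le_crackMeasure K)).mono_set sdiff_subset
  · have hφ' := hφ.mono sdiff_subset
    rw [restrict_diff_null hK0, h.deriv_eq φ hφ' i j, integral_crackMeasure hK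
      (hφ'.integrable_mul (h.integrable_density i j)) fun x hx => ?_]
    rw [image_eq_zero_of_notMem_tsupport fun hh => (hφ.2.2 hh).2 hx, zero_mul]

/-- Uniqueness for Lebesgue measure suffices: off the crack both the chosen density and the `L^p`
one are weak gradients, and `K` is a null set. -/
theorem MemW.memLp_derivDensity {p : ℝ≥0∞} {Ω K : Set (Vec n)} (hΩ : IsOpen Ω) (hKc : IsClosed K)
    (hK0 : volume K = 0) {u : Vec n → Vec n} (h : MemW p Ω (crackMeasure K) u) (i j : Fin n) :
    MemLp (fun x => derivDensity Ω (crackMeasure K) u x i j) p (volume.restrict Ω) := by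
  have h1 := h.isDerivDensity.diff hKc.measurableSet hK0
  obtain ⟨G, hG, hGp⟩ := h
  have h2 := (hG.diff hKc.measurableSet hK0).ae_eq (hΩ.sdiff hKc) h1
  rw [restrict_diff_null hK0] at h2
  refine ((hGp i j).mono_measure
    (Measure.restrict_mono le_rfl (volume_le_crackMeasure K))).ae_eq ?_
  filter_upwards [h2] with x hx
  rw [hx]

theorem IsDerivDensity.derivDensity_ae_eq {U : Set (Vec n)} (hU : IsOpen U) {u : Vec n → Vec n}
    {G : Vec n → Mat n} (h : IsDerivDensity U volume u G) :
    derivDensity U volume u =ᵐ[volume.restrict U] G := by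
  have h1 : ∃ G : Vec n → Mat n, IsDerivDensity U volume u G := ⟨G, h⟩
  rw [derivDensity, dif_pos h1]
  exact h1.choose_spec.ae_eq hU h

theorem MemSobolev.memLp_derivDensity {U : Set (Vec n)} (hU : IsOpen U) {w : Vec n → Vec n}
    (h : MemSobolev U w) (i j : Fin n) :
    MemLp (fun x => derivDensity U volume w x i j) 2 (volume.restrict U) := by
  obtain ⟨-, G, hG, hGp⟩ := h
  refine (hGp i j).ae_eq ?_
  filter_upwards [hG.derivDensity_ae_eq hU] with x hx
  rw [hx]

/-! ### Admissible stresses are orthogonal to gradients with zero trace -/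

/-- Row `i` of `σ` is paired with component `i` of `u - w`, extended by zero. Subtracting the two
Gauss-Green boundary terms gives exactly the weak gradient identity for the extension; test
functions supported off `K` do not see the surface part of `crackMeasure K`. -/
theorem integral_mul_eq_zero_of_sameTrace {Ω K : Set (Vec n)} (hΩ : IsOpen Ω)
    (hΩb : Bornology.IsBounded Ω) (hΩL : HasLipschitzBoundary Ω) (hKc : IsClosed K) (hKΩ : K ⊆ Ω)
    (hK0 : volume K = 0) {σ : Vec n → Mat n} (hσ : IsAdmissibleStress Ω K σ)
    {u w : Vec n → Vec n} (hu : MemW 2 Ω (crackMeasure K) u) (hw : MemSobolev Ω w)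
    (huw : SameTrace Ω volume w (crackMeasure K) u) (i : Fin n) :
    ∑ j, ∫ x in Ω, σ x i j * (derivDensity Ω (crackMeasure K) u x i j
      - derivDensity Ω volume w x i j) = 0 := by
  classical
  have hDu := hu.isDerivDensity
  have hDw := hw.2.isDerivDensity
  set A := derivDensity Ω (crackMeasure K) u with hA
  set B := derivDensity Ω volume w with hB
  have hAint : ∀ j, IntegrableOn (fun x => A x i j) Ω volume := fun j =>
    (hDu.integrable_density i j).mono_measure (volume_le_crackMeasure K)
  have hvint : IntegrableOn (fun x => u x i - w x i) Ω volume :=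
    (hDu.integrable_apply i).sub (hDw.integrable_apply i)
  have hgint : ∀ j, IntegrableOn (fun x => A x i j - B x i j) Ω volume := fun j =>
    (hAint j).sub (hDw.integrable_density i j)
  have hgrad : HasWeakGrad Kᶜ (Ω.indicator fun x => u x i - w x i)
      (fun j => Ω.indicator fun x => A x i j - B x i j) := by
    refine ⟨(integrable_indicator_iff hΩ.measurableSet).2 hvint,
      fun j => (integrable_indicator_iff hΩ.measurableSet).2 (hgint j), fun φ hφ j => ?_⟩
    have h1 := huw φ (hφ.mono (subset_univ _)) i j
    rw [boundaryTerm, boundaryTerm, ← hA, ← hB, integral_crackMeasure hKc.measurableSet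
      (hφ.integrable_mul (hDu.integrable_density i j)) (fun x hx => by
        rw [image_eq_zero_of_notMem_tsupport fun hh => hφ.2.2 hh hx, zero_mul])] at h1
    have e1 : ∫ x, Ω.indicator (fun x => u x i - w x i) x * pderiv j φ x
        = (∫ x in Ω, u x i * pderiv j φ x) - ∫ x in Ω, w x i * pderiv j φ x := by
      rw [← integral_sub (hφ.integrable_mul_pderiv (hDu.integrable_apply i) j)
        (hφ.integrable_mul_pderiv (hDw.integrable_apply i) j), ← integral_indicator hΩ.measurableSet]
      refine integral_congr_ae (ae_of_all _ fun x => ?_)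
      by_cases hx : x ∈ Ω <;> simp [hx, sub_mul]
    have e2 : ∫ x, φ x * Ω.indicator (fun x => A x i j - B x i j) x
        = (∫ x in Ω, φ x * A x i j) - ∫ x in Ω, φ x * B x i j := by
      rw [← integral_sub (hφ.integrable_mul (hAint j))
        (hφ.integrable_mul (hDw.integrable_density i j)), ← integral_indicator hΩ.measurableSet]
      refine integral_congr_ae (ae_of_all _ fun x => ?_)
      by_cases hx : x ∈ Ω <;> simp [hx, mul_sub]
    rw [e1, e2]
    linarith
  have hmain := hgrad.integral_sum_eq_zero hΩ hΩb hΩL hKc hKΩ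
    (τ := fun j => Ω.indicator fun x => σ x i j)
    (fun j => (memLp_indicator_iff_restrict hΩ.measurableSet).2 (hσ.memLp i j)) ?_ ?_
    (fun j => (memLp_indicator_iff_restrict hΩ.measurableSet).2
      ((hu.memLp_derivDensity hΩ hKc hK0 i j).sub (hw.memLp_derivDensity hΩ i j)))
    (fun x hx => indicator_of_notMem hx _) (fun j x hx => indicator_of_notMem hx _)
  · rw [← hmain]
    refine Finset.sum_congr rfl fun j _ => ?_
    rw [← integral_indicator hΩ.measurableSet]
    refine integral_congr_ae (ae_of_all _ fun x => ?_)
    by_cases hx : x ∈ Ω <;> simp [hx]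
  · intro φ hφ
    have hfin : IsFiniteMeasure (volume.restrict Ω) :=
      ⟨by rw [Measure.restrict_apply_univ]; exact hΩb.measure_lt_top⟩
    rw [← hσ.div_eq_zero φ hφ i, integral_finsetSum _ fun j _ =>
      hφ.integrable_mul_pderiv ((hσ.memLp i j).integrable (by norm_num)) j]
    refine Finset.sum_congr rfl fun j _ => ?_
    rw [← integral_indicator hΩ.measurableSet]
    refine integral_congr_ae (ae_of_all _ fun x => ?_)
    by_cases hx : x ∈ Ω <;> simp [hx]
  · rintro v g hvg hv hg ⟨S, hS, hSΩ, hvS, hgS⟩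
    -- The scalar function `v` is tested as the vector field `v eᵢ`, whose gradient has only row
    -- `i`; the full product with `σ` then reduces to that row.
    set G : Vec n → Mat n := fun x => Matrix.of fun a b => if a = i then g b x else 0 with hG
    set φ : Vec n → Vec n := fun x => v x • EuclideanSpace.single i (1 : ℝ) with hφdef
    have hφ2 : MemLp φ 2 volume :=
      hv.of_le (hv.1.smul_const _) (ae_of_all _ fun x => by simp [hφdef, norm_smul])
    have hφint : Integrable φ volume := by
      refine hvg.integrable.mono hφ2.1 (ae_of_all _ fun x => by simp [hφdef, norm_smul])
    have hφG : IsDerivDensity (Ω \ K) volume φ G := by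
      refine ⟨hφint.integrableOn, fun a b => ?_, fun ψ hψ a b => ?_⟩
      · by_cases ha : a = i
        · simpa [hG, ha] using (hvg.integrable_grad b).integrableOn
        · simp [hG, ha]
      · by_cases ha : a = i
        · subst ha
          have h1 := hvg.integral_eq ψ hψ b
          simp only [hG, hφdef, Matrix.of_apply, if_true, PiLp.smul_apply, PiLp.single_apply,
            smul_eq_mul, mul_one]
          rw [setIntegral_eq_integral_of_forall_compl_eq_zero,
            setIntegral_eq_integral_of_forall_compl_eq_zero, h1]
          · intro x hx
            rw [image_eq_zero_of_notMem_tsupport fun hh => hx (hψ.2.2 hh), zero_mul]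
          · intro x hx
            rw [pderiv, image_eq_zero_of_notMem_tsupport
              fun hh => hx (hψ.2.2 (tsupport_fderiv_subset ℝ hh))]
            simp
        · simp [hG, hφdef, ha]
    have hφS : MemSobolev (Ω \ K) φ := by
      refine ⟨hφ2.restrict _, G, hφG, fun a b => ?_⟩
      by_cases ha : a = i
      · simpa [hG, ha] using (hg b).restrict _
      · simp [hG, ha]
    have h0 := hσ.normal_eq_zero φ hφS ⟨S, hS, hSΩ, fun x hx => by simp [hφdef, hvS x hx]⟩
    have h1 : ∫ x in Ω \ K, ddot (σ x) (derivDensity (Ω \ K) volume φ x)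
        = ∫ x in Ω, ∑ j, σ x i j * g j x := by
      rw [← restrict_diff_null (Ω := Ω) hK0]
      refine integral_congr_ae ?_
      filter_upwards [hφG.derivDensity_ae_eq (hΩ.sdiff hKc)] with x hx
      rw [hx, ddot, Finset.sum_eq_single i]
      · simp [hG]
      · intro a _ ha
        simp [hG, ha]
      · simp
    have hi : ∀ j, Integrable (fun x => σ x i j * g j x) (volume.restrict Ω) := fun j =>
      (hσ.memLp i j).integrable_mul ((hg j).restrict Ω)
    rw [← h0, h1, integral_finsetSum _ fun j _ => hi j]
    refine Finset.sum_congr rfl fun j _ => ?_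
    rw [← integral_indicator hΩ.measurableSet]
    refine integral_congr_ae (ae_of_all _ fun x => ?_)
    by_cases hx : x ∈ Ω <;> simp [hx]

/-! ### Removing the crack without changing the boundary values -/

theorem exists_isTest_eq_one {Ω K : Set (Vec n)} (hΩ : IsOpen Ω) (hK : IsCompact K)
    (hKΩ : K ⊆ Ω) : ∃ η : Vec n → ℝ, IsTest Ω η ∧ ∀ x ∈ K, η x = 1 := by
  obtain ⟨t, ht, hKt, htΩ⟩ := exists_compact_between hK hΩ hKΩ
  obtain ⟨f, hf1, hf0, -⟩ := exists_contMDiffMap_one_nhds_of_subset_interior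
    (modelWithCornersSelf ℝ (Vec n)) (n := ⊤) hK.isClosed hKt
  have hsub : Function.support f ⊆ t := fun x hx => by
    by_contra hxt
    exact hx (hf0 x hxt)
  exact ⟨f, ⟨f.contMDiff.contDiff, HasCompactSupport.of_support_subset_isCompact ht hsub,
    (closure_minimal hsub ht.isClosed).trans htΩ⟩, fun x hx => hf1.self_of_nhdsSet x hx⟩

/-- Take `w = (1 - η) u` with `η` compactly supported in `Ω` and equal to 1 on `K`: the jump is
erased and the boundary values are kept. The assumption `hub` puts `u` and the Leibniz term `u ∂η`
in `L²`. -/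
theorem exists_memSobolev_sameTrace {Ω K : Set (Vec n)} (hΩ : IsOpen Ω)
    (hΩb : Bornology.IsBounded Ω) (hKc : IsClosed K) (hKΩ : K ⊆ Ω) (hK0 : volume K = 0)
    {u : Vec n → Vec n} (hu : MemW 2 Ω (crackMeasure K) u)
    (hub : MemLp u 2 (volume.restrict Ω)) :
    ∃ w : Vec n → Vec n, MemSobolev Ω w ∧ SameTrace Ω volume w (crackMeasure K) u := by
  obtain ⟨η, hη, hη1⟩ := exists_isTest_eq_one hΩ
    (Metric.isCompact_of_isClosed_isBounded hKc (hΩb.subset hKΩ)) hKΩ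
  have hD := hu.isDerivDensity
  have hD2 := fun i j => hu.memLp_derivDensity hΩ hKc hK0 i j
  set D := derivDensity Ω (crackMeasure K) u with hDdef
  have hDint : ∀ i j, IntegrableOn (fun x => D x i j) Ω volume := fun i j =>
    (hD.integrable_density i j).mono_measure (volume_le_crackMeasure K)
  have hu2 : ∀ i, MemLp (fun x => u x i) 2 (volume.restrict Ω) := fun i =>
    hub.of_le ((EuclideanSpace.proj (𝕜 := ℝ) i : Vec n →L[ℝ] ℝ).continuous.comp_aestronglyMeasurable
      hub.1) (ae_of_all _ fun x => PiLp.norm_apply_le (u x) i)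
  set w : Vec n → Vec n := fun x => u x - η x • u x with hw
  set G : Vec n → Mat n := fun x => Matrix.of fun i j =>
    D x i j - (η x * D x i j + u x i * pderiv j η x) with hG
  obtain ⟨c, hc⟩ := hη.exists_bound
  have hGint : ∀ i j, IntegrableOn (fun x => G x i j) Ω volume := fun i j =>
    (hDint i j).sub ((hη.integrable_mul (hDint i j)).add
      (hη.integrable_mul_pderiv (hD.integrable_apply i) j))
  -- One identity serves twice: for `φ` supported in `Ω` its right side vanishes, so `G` is the weak
  -- gradient of `w`; for general `φ` it is the equality of traces. It follows by testing the
  -- derivative of `u` with `η φ`.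
  have hterm : ∀ φ : Vec n → ℝ, IsTest univ φ → ∀ i j,
      (∫ x in Ω, w x i * pderiv j φ x) + ∫ x in Ω, φ x * G x i j
        = (∫ x in Ω, u x i * pderiv j φ x) + ∫ x in Ω, φ x * D x i j ∂(crackMeasure K) := by
    intro φ hφ i j
    have hηφ : IsTest Ω (fun x => η x * φ x) := hφ.mul_left hη.1 (fun x hx => hη.2.2 hx.1)
    have h1 := hD.deriv_eq _ hηφ i j
    have i1 := hφ.integrable_mul_pderiv (hD.integrable_apply i) j
    have i2 := hη.integrable_mul i1
    have i3 := hφ.integrable_mul (hη.integrable_mul_pderiv (hD.integrable_apply i) j)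
    have i4 := hφ.integrable_mul (hD.integrable_density i j)
    have i5 := hηφ.integrable_mul (hD.integrable_density i j)
    have i6 := hφ.integrable_mul (hDint i j)
    have i7 := hηφ.integrable_mul (hDint i j)
    have e1 : ∫ x in Ω, u x i * pderiv j (fun x => η x * φ x) x
        = (∫ x in Ω, η x * (u x i * pderiv j φ x)) + ∫ x in Ω, φ x * (u x i * pderiv j η x) := by
      rw [← integral_add i2 i3]
      refine integral_congr_ae (ae_of_all _ fun x => ?_)
      simp only [pderiv_mul hη.1 hφ.1]
      ring
    have e2 : ∫ x in Ω, w x i * pderiv j φ x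
        = (∫ x in Ω, u x i * pderiv j φ x) - ∫ x in Ω, η x * (u x i * pderiv j φ x) := by
      rw [← integral_sub i1 i2]
      refine integral_congr_ae (ae_of_all _ fun x => ?_)
      simp only [hw, PiLp.sub_apply, PiLp.smul_apply, smul_eq_mul]
      ring
    have e3 : ∫ x in Ω, φ x * G x i j = (∫ x in Ω, (φ x * D x i j - η x * φ x * D x i j))
        - ∫ x in Ω, φ x * (u x i * pderiv j η x) := by
      have i8 : Integrable (fun x => φ x * D x i j - η x * φ x * D x i j) (volume.restrict Ω) :=
        i6.sub i7
      rw [← integral_sub i8 i3]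
      refine integral_congr_ae (ae_of_all _ fun x => ?_)
      simp only [hG, Matrix.of_apply]
      ring
    -- The integrand is `(1 - η) φ D`, which vanishes on `K`, so the surface measure contributes
    -- nothing.
    have e4 : ∫ x in Ω, (φ x * D x i j - η x * φ x * D x i j)
        = ∫ x in Ω, (φ x * D x i j - η x * φ x * D x i j) ∂(crackMeasure K) :=
      (integral_crackMeasure hKc.measurableSet (i4.sub i5) fun x hx => by simp [hη1 x hx]).symm
    rw [integral_sub i4 i5] at e4
    rw [e2, e3, e4]
    rw [e1] at h1
    linarith
  have hwint : IntegrableOn w Ω volume := by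
    refine hD.integrable.sub ?_
    exact hD.integrable.bdd_smul c hη.continuous.aestronglyMeasurable (ae_of_all _ hc)
  have hwG : IsDerivDensity Ω volume w G := by
    refine ⟨hwint, hGint, fun φ hφ i j => ?_⟩
    have h1 := hterm φ (hφ.mono (subset_univ _)) i j
    rw [hD.deriv_eq φ hφ i j] at h1
    linarith
  refine ⟨w, ⟨?_, G, hwG, fun i j => ?_⟩, fun φ hφ i j => ?_⟩
  · refine hub.sub (hub.of_le_mul (c := c) (hη.continuous.aestronglyMeasurable.smul hub.1)
      (ae_of_all _ fun x => ?_))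
    rw [norm_smul]
    gcongr
    exact hc x
  · exact (hD2 i j).sub ((hη.memLp_mul (hD2 i j)).add (hη.memLp_mul_pderiv (hu2 i) j))
  · rw [boundaryTerm, boundaryTerm, ← hDdef, ← hterm φ hφ i j]
    congr 1
    refine integral_congr_ae ?_
    filter_upwards [hwG.derivDensity_ae_eq hΩ] with x hx
    rw [hx]

/-! ### Duality of elastic energies -/

theorem tensorInv_spec {C : Fin n → Fin n → Fin n → Fin n → ℝ} (hC : IsElasticityTensor C)
    {s : Mat n} (hs : s.IsSymm) : (tensorInv C s).IsSymm ∧ tensorApply C (tensorInv C s) = s := by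
  obtain ⟨e, ⟨he, hes⟩, -⟩ := existsUnique_tensorApply_eq hC hs
  have h : ∃ a ∈ {e : Mat n | e.IsSymm}, tensorApply C a = s := ⟨e, he, hes⟩
  exact ⟨Function.invFunOn_mem h, Function.invFunOn_eq h⟩

theorem tensorApply_add (C : Fin n → Fin n → Fin n → Fin n → ℝ) (a b : Mat n) :
    tensorApply C (a + b) = tensorApply C a + tensorApply C b := by
  ext i j
  simp [tensorApply, mul_add, Finset.sum_add_distrib]

theorem tensorApply_smul (C : Fin n → Fin n → Fin n → Fin n → ℝ) (c : ℝ) (a : Mat n) :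
    tensorApply C (c • a) = c • tensorApply C a := by
  ext i j
  simp only [tensorApply, Matrix.of_apply, Matrix.smul_apply, smul_eq_mul, Finset.mul_sum]
  exact Finset.sum_congr rfl fun k _ => Finset.sum_congr rfl fun l _ => by ring

theorem ddot_comm (a b : Mat n) : ddot a b = ddot b a := by
  simp only [ddot, mul_comm]

theorem ddot_add_left (a b z : Mat n) : ddot (a + b) z = ddot a z + ddot b z := by
  simp [ddot, add_mul, Finset.sum_add_distrib]

theorem ddot_smul_left (c : ℝ) (a z : Mat n) : ddot (c • a) z = c * ddot a z := by
  simp [ddot, Finset.mul_sum, mul_assoc]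

theorem ddot_self_nonneg (a : Mat n) : 0 ≤ ddot a a :=
  Finset.sum_nonneg fun _ _ => Finset.sum_nonneg fun _ _ => mul_self_nonneg _

theorem ddot_tensorApply_comm {C : Fin n → Fin n → Fin n → Fin n → ℝ}
    (hC : IsElasticityTensor C) (a b : Mat n) :
    ddot (tensorApply C a) b = ddot (tensorApply C b) a := by
  simp only [ddot, tensorApply, Matrix.of_apply, Finset.sum_mul]
  have hswap : ∀ F : Fin n → Fin n → Fin n → Fin n → ℝ,
      ∑ i, ∑ j, ∑ k, ∑ l, F i j k l = ∑ i, ∑ j, ∑ k, ∑ l, F k l i j := fun F => by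
    have h := Finset.sum_comm (s := Finset.univ) (t := Finset.univ)
      (f := fun p q : Fin n × Fin n => F p.1 p.2 q.1 q.2)
    simpa only [Fintype.sum_prod_type] using h
  rw [hswap]
  refine Finset.sum_congr rfl fun i _ => Finset.sum_congr rfl fun j _ =>
    Finset.sum_congr rfl fun k _ => Finset.sum_congr rfl fun l _ => ?_
  rw [hC.symm_major k l i j]
  ring

/-- Fenchel's inequality for the elastic energy density. -/
theorem ddot_sub_half_tensorInv_le {C : Fin n → Fin n → Fin n → Fin n → ℝ}
    (hC : IsElasticityTensor C) {s : Mat n} (hs : s.IsSymm) (z : Mat n) :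
    ddot s z - 1 / 2 * ddot (tensorInv C s) s ≤ 1 / 2 * ddot (tensorApply C z) z := by
  obtain ⟨-, he⟩ := tensorInv_spec hC hs
  set e := tensorInv C s
  obtain ⟨c, hc, hpos⟩ := hC.pos
  -- Positivity of the energy density at `z - e`; after expansion the two cross terms agree by the
  -- major symmetry of `C`.
  have h1 := (mul_nonneg hc.le (ddot_self_nonneg _)).trans (hpos (z + (-1 : ℝ) • e))
  rw [tensorApply_add, tensorApply_smul, he, ddot_add_left, ddot_smul_left,
    ddot_comm _ (z + _), ddot_comm s (z + _), ddot_add_left, ddot_add_left, ddot_smul_left,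
    ddot_smul_left] at h1
  have h2 : ddot e (tensorApply C z) = ddot s z := by
    rw [ddot_comm, ddot_tensorApply_comm hC, he]
  rw [h2, ddot_comm z (tensorApply C z), ddot_comm z s] at h1
  linarith

/-- `tensorInv` is defined pointwise by choice, so measurability and `L²` bounds for `C⁻¹σ` are not
evident. By uniqueness it is linear on symmetric matrices, and `symPart` extends it linearly to all
matrices. -/
theorem exists_linearMap_tensorInv {C : Fin n → Fin n → Fin n → Fin n → ℝ}
    (hC : IsElasticityTensor C) :
    ∃ B : Mat n →ₗ[ℝ] Mat n, ∀ s : Mat n, s.IsSymm → B s = tensorInv C s := by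
  have hsym : ∀ z : Mat n, (symPart z).IsSymm := fun z => by
    ext i j
    simp [symPart]
    ring
  have huniq : ∀ s e : Mat n, s.IsSymm → e.IsSymm → tensorApply C e = s → tensorInv C s = e :=
    fun s e hs he hes =>
      (existsUnique_tensorApply_eq hC hs).unique (tensorInv_spec hC hs) ⟨he, hes⟩
  refine ⟨{ toFun := fun z => tensorInv C (symPart z), map_add' := ?_, map_smul' := ?_ }, ?_⟩
  · intro a b
    refine huniq _ _ (hsym _) ((tensorInv_spec hC (hsym a)).1.add (tensorInv_spec hC (hsym b)).1) ?_
    rw [tensorApply_add, (tensorInv_spec hC (hsym a)).2, (tensorInv_spec hC (hsym b)).2]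
    ext i j
    simp [symPart]
    ring
  · intro c a
    refine huniq _ _ (hsym _) ((tensorInv_spec hC (hsym a)).1.smul c) ?_
    rw [tensorApply_smul, (tensorInv_spec hC (hsym a)).2]
    ext i j
    simp [symPart]
    ring
  · intro s hs
    have : symPart s = s := by
      ext i j
      simp [symPart, hs.apply i j]
      ring
    simp [this]

theorem integrable_ddot {α : Type*} [MeasurableSpace α] {μ : Measure α} {A B : α → Mat n}
    (hA : ∀ i j, MemLp (fun x => A x i j) 2 μ) (hB : ∀ i j, MemLp (fun x => B x i j) 2 μ) :
    Integrable (fun x => ddot (A x) (B x)) μ :=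
  integrable_finsetSum _ fun i _ => integrable_finsetSum _ fun j _ =>
    (hA i j).integrable_mul (hB i j)

theorem memLp_tensorApply {α : Type*} [MeasurableSpace α] {μ : Measure α} {p : ℝ≥0∞}
    (C : Fin n → Fin n → Fin n → Fin n → ℝ) {A : α → Mat n}
    (hA : ∀ i j, MemLp (fun x => A x i j) p μ) (i j : Fin n) :
    MemLp (fun x => tensorApply C (A x) i j) p μ := by
  simp only [tensorApply, Matrix.of_apply]
  exact memLp_finsetSum _ fun k _ => memLp_finsetSum _ fun l _ => (hA k l).const_mul (C i j k l)

theorem memLp_linearMap {α : Type*} [MeasurableSpace α] {μ : Measure α} {p : ℝ≥0∞}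
    (B : Mat n →ₗ[ℝ] Mat n) {A : α → Mat n}
    (hA : ∀ i j, MemLp (fun x => A x i j) p μ) (i j : Fin n) :
    MemLp (fun x => B (A x) i j) p μ := by
  have h : ∀ z : Mat n, B z i j = ∑ k, ∑ l, B (Matrix.single k l 1) i j * z k l := by
    intro z
    conv_lhs => rw [Matrix.matrix_eq_sum_single z]
    simp only [map_sum, Matrix.sum_apply]
    refine Finset.sum_congr rfl fun k _ => Finset.sum_congr rfl fun l _ => ?_
    rw [show Matrix.single k l (z k l) = z k l • Matrix.single k l (1 : ℝ) by simp, map_smul,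
      Matrix.smul_apply, smul_eq_mul, mul_comm]
  rw [funext fun x => h (A x)]
  exact memLp_finsetSum _ fun k _ => memLp_finsetSum _ fun l _ => (hA k l).const_mul _

end CrackedBody

/-! ### The duality inequality. -/

theorem proposition2p4 (n : ℕ) (hn : 1 ≤ n)
    (Ω : Set (CrackedBody.Vec n)) (hΩ : IsOpen Ω) (hΩb : Bornology.IsBounded Ω)
    (hΩL : CrackedBody.HasLipschitzBoundary Ω)
    (K : Set (CrackedBody.Vec n)) (hKc : IsClosed K) (hKΩ : K ⊆ Ω)
    (hKr : CrackedBody.IsCountablyRectifiable K)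
    (hKfin : Measure.hausdorffMeasure ((n : ℝ) - 1) K < ⊤)
    (C : Fin n → Fin n → Fin n → Fin n → ℝ) (hC : CrackedBody.IsElasticityTensor C)
    (u₀ : CrackedBody.Vec n → CrackedBody.Vec n)
    (hu₀ : CrackedBody.MemW 2 Ω (CrackedBody.crackMeasure K) u₀)
    (hu₀b : MemLp u₀ ⊤ (volume.restrict Ω))
    (σ : CrackedBody.Vec n → CrackedBody.Mat n) (hσ : CrackedBody.IsAdmissibleStress Ω K σ)
    (u : CrackedBody.Vec n → CrackedBody.Vec n) (hu : CrackedBody.IsMinimizer C Ω K u₀ u) :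
    ∃ t : ℝ, CrackedBody.IsNormalTracePairing Ω (CrackedBody.crackMeasure K) σ u₀ t ∧
      t - 1 / 2 * ∫ x in Ω, CrackedBody.ddot (CrackedBody.tensorInv C (σ x)) (σ x)
        ≤ CrackedBody.energy C Ω K u := by
  open CrackedBody in
  have hK0 := volume_eq_zero_of_hausdorffMeasure_lt_top hKfin
  have hfin : IsFiniteMeasure (volume.restrict Ω) :=
    ⟨by rw [Measure.restrict_apply_univ]; exact hΩb.measure_lt_top⟩
  obtain ⟨hu1, hutr⟩ := hu.1
  have hA2 := hu1.memLp_derivDensity hΩ hKc hK0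
  -- The value of the pairing is taken to be `∫ σ : ∇u`: its independence of `w` is then the
  -- orthogonality of `σ` to `∇u - ∇w`, and the inequality is the integrated Fenchel inequality.
  refine ⟨∫ x in Ω, ddot (σ x) (derivDensity Ω (crackMeasure K) u x),
    ⟨exists_memSobolev_sameTrace hΩ hΩb hKc hKΩ hK0 hu₀ (hu₀b.mono_exponent le_top),
      fun w hw hwtr => ?_⟩, ?_⟩
  · have htr : SameTrace Ω volume w (crackMeasure K) u := fun φ hφ i j =>
      (hwtr φ hφ i j).trans (hutr φ hφ i j).symm
    have hB2 := hw.memLp_derivDensity hΩ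
    have h1 : ∫ x in Ω, ddot (σ x) (derivDensity Ω (crackMeasure K) u x
        - derivDensity Ω volume w x) = 0 := by
      have hi : ∀ i j, Integrable (fun x => σ x i j * (derivDensity Ω (crackMeasure K) u x
          - derivDensity Ω volume w x) i j) (volume.restrict Ω) := fun i j =>
        (hσ.memLp i j).integrable_mul ((hA2 i j).sub (hB2 i j))
      simp only [ddot]
      rw [integral_finsetSum _ fun i _ => integrable_finsetSum _ fun j _ => hi i j]
      refine Finset.sum_eq_zero fun i _ => ?_
      rw [integral_finsetSum _ fun j _ => hi i j]
      exact integral_mul_eq_zero_of_sameTrace hΩ hΩb hΩL hKc hKΩ hK0 hσ hu1 hw htr i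
    have h2 : ∀ x, ddot (σ x) (derivDensity Ω (crackMeasure K) u x - derivDensity Ω volume w x)
        = ddot (σ x) (derivDensity Ω (crackMeasure K) u x)
          - ddot (σ x) (derivDensity Ω volume w x) := fun x => by
      simp [ddot, mul_sub, Finset.sum_sub_distrib]
    simp only [h2] at h1
    rw [integral_sub (integrable_ddot hσ.memLp hA2) (integrable_ddot hσ.memLp hB2)] at h1
    linarith
  · obtain ⟨B, hB⟩ := exists_linearMap_tensorInv hC
    have hinv : Integrable (fun x => ddot (tensorInv C (σ x)) (σ x)) (volume.restrict Ω) := by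
      refine (integrable_ddot (memLp_linearMap B hσ.memLp) hσ.memLp).congr ?_
      filter_upwards [hσ.symm] with x hx
      rw [hB _ hx]
    rw [energy, ← integral_const_mul, ← integral_const_mul,
      ← integral_sub (integrable_ddot hσ.memLp hA2) (hinv.const_mul _)]
    refine integral_mono_ae ((integrable_ddot hσ.memLp hA2).sub (hinv.const_mul _))
      ((integrable_ddot (memLp_tensorApply C hA2) hA2).const_mul _) ?_
    filter_upwards [hσ.symm] with x hx
    exact ddot_sub_half_tensorInv_le hC hx _
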